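/- We work in $\mathrm{ZFC}_P$: $V$ is the universe of sets, $P$ is a class (a predicate on sets), and Separation and Replacement are allowed for formulas mentioning $P$. Formulas are in the language $\{\in,P\}$, and $\Sigma_n$ refers to the Lévy hierarchy of this language. For $n\ge 1$ let $C^{(n)}_P$ be the class of all ordinals $\alpha$ such that $$\langle V_\alpha,\in,P\cap V_\alpha\rangle\prec_{\Sigma_n}\langle V,\in,P\rangle .$$ Let $\kappa$ be a cardinal and $n\geq 1$. * $\kappa$ is *$P$-$C^{(n)}$-extendible* if for every cardinal $\lambda>\kappa$ in $C^{(n)}_P$ there are an ordinal $\theta$ and an elementary embedding $j:\langle V_\lambda,\in,P\cap V_\lambda\rangle\to\langle V_\theta,\in,P\cap V_\theta\rangle$ with $\mathrm{crit}(j)=\kappa$, $j(\kappa)>\lambda$ and $j(\kappa)\in C^{(n)}_P$. * $\kappa$ is *$P$-$C^{(n)+}$-extendible* if, moreover, for every such $\lambda$ one can choose $\theta\in C^{(n)}_P$. * $\kappa$ is *$P$-$\Sigma_n$-supercompact* if for every $\lambda>\kappa$ in $C^{(n)}_P$ and every $a\in V_\lambda$ there are ordinals $\bar\delta<\bar\lambda<\kappa$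 with $\bar\lambda\in C^{(n)}_P$, a set $\bar a\in V_{\bar\lambda}$, and an elementary embedding $j:\langle V_{\bar\lambda},\in,P\cap V_{\bar\lambda}\rangle\to\langle V_\lambda,\in,P\cap V_\lambda\rangle$ with $\mathrm{crit}(j)=\bar\delta$, $j(\bar\delta)=\kappa$ and $j(\bar a)=a$. **Theorem.** For every $n\ge 1$, every class $P$ and every cardinal $\kappa$, the following are equivalent: 1. $\kappa$ is $P$-$C^{(n)}$-extendible; 2. $\kappa$ is $P$-$\Sigma_{n+1}$-supercompact; 3. $\kappa$ is $P$-$C^{(n)+}$-extendible. -/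

import Mathlib

universe u

namespace PredSet

open FirstOrder FirstOrder.Language

/-- Relation symbols of the language of set theory with an extra predicate. -/
inductive Rel : ℕ → Type
  | mem : Rel 2
  | pred : Rel 1

/-- The first-order language with a binary symbol for membership and a unary symbol for `P`. -/
def Lang : FirstOrder.Language.{0, 0} := ⟨fun _ => Empty, Rel⟩

/-- The membership symbol. -/
def memSym : Lang.Relations 2 := Rel.mem

/-- The predicate symbol. -/
def predSym : Lang.Relations 1 := Rel.pred

/-- The formula `s ∈ t`. -/
def memF {γ : Type} {k : ℕ} (s t : Lang.Term (γ ⊕ Fin k)) : Lang.BoundedFormula γ k :=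
  memSym.boundedFormula₂ s t

/-- The formula `P(t)`. -/
def predF {γ : Type} {k : ℕ} (t : Lang.Term (γ ⊕ Fin k)) : Lang.BoundedFormula γ k :=
  predSym.boundedFormula₁ t

/-- The bounded quantification `∀ x ∈ t, φ(x)`; the new variable `x` is `&k`, and it does not
occur in `t`. -/
def ballF {γ : Type} {k : ℕ} (t : Lang.Term (γ ⊕ Fin k)) (φ : Lang.BoundedFormula γ (k + 1)) :
    Lang.BoundedFormula γ k :=
  ((memF (Term.var (Sum.inr (Fin.last k))) (t.relabel (Sum.map id Fin.castSucc))).imp φ).all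

/-- `Δ₀` formulas: built from atomic formulas by `⊥`, `→` (hence all connectives) and bounded
quantification `∀ x ∈ t` (hence also `∃ x ∈ t`, as `¬ ∀ x ∈ t, ¬`). -/
inductive IsDeltaZero {γ : Type} : ∀ {k : ℕ}, Lang.BoundedFormula γ k → Prop
  | falsum {k : ℕ} : IsDeltaZero (BoundedFormula.falsum : Lang.BoundedFormula γ k)
  | equal {k : ℕ} (s t : Lang.Term (γ ⊕ Fin k)) : IsDeltaZero (BoundedFormula.equal s t)
  | mem {k : ℕ} (s t : Lang.Term (γ ⊕ Fin k)) : IsDeltaZero (memF s t)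
  | pred {k : ℕ} (t : Lang.Term (γ ⊕ Fin k)) : IsDeltaZero (predF t)
  | imp {k : ℕ} {φ ψ : Lang.BoundedFormula γ k} :
      IsDeltaZero φ → IsDeltaZero ψ → IsDeltaZero (φ.imp ψ)
  | ball {k : ℕ} (t : Lang.Term (γ ⊕ Fin k)) {φ : Lang.BoundedFormula γ (k + 1)} :
      IsDeltaZero φ → IsDeltaZero (ballF t φ)

/-- The Lévy hierarchy (with the extra predicate). `Σ₀` formulas are the `Δ₀` formulas, and the
`Σₙ₊₁` formulas are those of the form `∃ x₁ ⋯ ∃ xᵣ ψ` (`r ≥ 0`) with `ψ` a `Πₙ` formula, i.e. the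
negation of a `Σₙ` formula, or with `ψ` a `Δ₀` formula. -/
inductive IsSigma {γ : Type} : ℕ → ∀ {k : ℕ}, Lang.BoundedFormula γ k → Prop
  | delta {n k : ℕ} {φ : Lang.BoundedFormula γ k} : IsDeltaZero φ → IsSigma n φ
  | neg {n k : ℕ} {φ : Lang.BoundedFormula γ k} : IsSigma n φ → IsSigma (n + 1) φ.not
  | ex {n k : ℕ} {φ : Lang.BoundedFormula γ (k + 1)} :
      IsSigma (n + 1) φ → IsSigma (n + 1) φ.ex

/-- The carrier of the structure `⟨V, ∈, P⟩`. -/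
def Universe (_P : Class.{u}) : Type (u + 1) := ZFSet.{u}

/-- The carrier of the structure `⟨V_a, ∈, P ∩ V_a⟩`. -/
def Level (_P : Class.{u}) (a : Ordinal.{u}) : Type (u + 1) :=
  {x : ZFSet.{u} // x ∈ ZFSet.vonNeumann a}

/-- The set underlying an element of `V`. -/
def Universe.toSet {P : Class.{u}} (x : Universe P) : ZFSet.{u} := x

/-- The set underlying an element of `V_a`. -/
def Level.toSet {P : Class.{u}} {a : Ordinal.{u}} (x : Level P a) : ZFSet.{u} := x.1

/-- The inclusion of `V_a` in `V`. -/
def Level.incl {P : Class.{u}} {a : Ordinal.{u}} (x : Level P a) : Universe P := x.1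

/-- The structure `⟨V, ∈, P⟩`. -/
instance Universe.instStructure (P : Class.{u}) : Lang.Structure (Universe P) where
  funMap := fun f _ => Empty.elim f
  RelMap := fun {_} r => match r with
    | Rel.mem => fun v => (v 0).toSet ∈ (v 1).toSet
    | Rel.pred => fun v => P (v 0).toSet

/-- The structure `⟨V_a, ∈, P ∩ V_a⟩`. -/
instance Level.instStructure (P : Class.{u}) (a : Ordinal.{u}) : Lang.Structure (Level P a) where
  funMap := fun f _ => Empty.elim f
  RelMap := fun {_} r => match r with
    | Rel.mem => fun v => (v 0).toSet ∈ (v 1).toSet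
    | Rel.pred => fun v => P (v 0).toSet

/-- The class of all ordinals `a` such that `⟨V_a, ∈, P ∩ V_a⟩` is a `Σₙ`-elementary substructure
of `⟨V, ∈, P⟩`. -/
def Correct (P : Class.{u}) (n : ℕ) : Set Ordinal.{u} :=
  {a | ∀ (m : ℕ) (φ : Lang.Formula (Fin m)), IsSigma n φ → ∀ v : Fin m → Level P a,
    (φ.Realize v ↔ φ.Realize (fun i => (v i).incl))}

/-- `j(a) = b`, for the ordinals `a` and `b` (as von Neumann ordinals). -/
def MapsOrd {P : Class.{u}} {l t : Ordinal.{u}} (j : Level P l ↪ₑ[Lang] Level P t)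
    (a b : Ordinal.{u}) : Prop :=
  ∃ x : Level P l, x.toSet = a.toZFSet ∧ (j x).toSet = b.toZFSet

/-- `crit(j) = c`: `c` is the least ordinal in the domain of `j` that is moved by `j`. -/
def IsCrit {P : Class.{u}} {l t : Ordinal.{u}} (j : Level P l ↪ₑ[Lang] Level P t)
    (c : Ordinal.{u}) : Prop :=
  c < l ∧ (∀ a < c, MapsOrd j a a) ∧ ¬ MapsOrd j c c

/-- `κ` is `P`-`C⁽ⁿ⁾`-extendible: for every cardinal `l > κ` that is `P`-`Σₙ`-correct there are an
ordinal `t` and an elementary `j : ⟨V_l, ∈, P ∩ V_l⟩ → ⟨V_t, ∈, P ∩ V_t⟩` with `crit(j) = κ`,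
`j(κ) > l` and `j(κ)` a `P`-`Σₙ`-correct ordinal. -/
def IsExtendible (P : Class.{u}) (n : ℕ) (κ : Cardinal.{u}) : Prop :=
  ∀ l : Cardinal.{u}, κ < l → l.ord ∈ Correct P n →
    ∃ (t : Ordinal.{u}) (j : Level P l.ord ↪ₑ[Lang] Level P t),
      IsCrit j κ.ord ∧ ∃ b ∈ Correct P n, l.ord < b ∧ MapsOrd j κ.ord b

/-- `κ` is `P`-`C⁽ⁿ⁾⁺`-extendible: as before, and moreover `t` can be chosen `P`-`Σₙ`-correct. -/
def IsExtendiblePlus (P : Class.{u}) (n : ℕ) (κ : Cardinal.{u}) : Prop :=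
  ∀ l : Cardinal.{u}, κ < l → l.ord ∈ Correct P n →
    ∃ t ∈ Correct P n, ∃ j : Level P l.ord ↪ₑ[Lang] Level P t,
      IsCrit j κ.ord ∧ ∃ b ∈ Correct P n, l.ord < b ∧ MapsOrd j κ.ord b

/-- `κ` is `P`-`Σₙ`-supercompact: for every `P`-`Σₙ`-correct `l > κ` and every `a ∈ V_l` there are
`d' < l' < κ` with `l'` `P`-`Σₙ`-correct, some `a' ∈ V_l'`, and an elementary
`j : ⟨V_l', ∈, P ∩ V_l'⟩ → ⟨V_l, ∈, P ∩ V_l⟩` with `crit(j) = d'`, `j(d') = κ` and `j(a') = a`. -/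
def IsSigmaSupercompact (P : Class.{u}) (n : ℕ) (κ : Cardinal.{u}) : Prop :=
  ∀ l ∈ Correct P n, κ.ord < l → ∀ a : Level P l,
    ∃ d' l' : Ordinal.{u}, d' < l' ∧ l' < κ.ord ∧ l' ∈ Correct P n ∧
      ∃ (a' : Level P l') (j : Level P l' ↪ₑ[Lang] Level P l),
        IsCrit j d' ∧ MapsOrd j d' κ.ord ∧ j a' = a

end PredSet

/-! From 1 to 2. Given a `Σₙ₊₁`-correct `l > κ` and `a ∈ V_l`, take fully reflecting cardinals `l <
ν < μ` and an extendibility embedding `j : V_μ → V_t` with `b = j(κ) > μ` in `C⁽ⁿ⁾`. Since `V_μ` is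
`Σₙ₊₁`-correct and `V_b` is `Σₙ`-correct, `V_μ ≺ V_b` for `Σₙ₊₁` formulas; as `j` fixes `V_κ`
pointwise and sends it to `V_b`, it follows that `κ` is `Σₙ₊₁`-correct. In the same way `V_l ≺ V_b`
for `Σₙ₊₁` formulas. So `V_l`, `V_κ`, `a` and `j` restricted to `V_l` witness that below `j(κ)`
there is a level, `Σₙ₊₁`-elementary in `V_{j(κ)}`, which embeds in `V_{j(l)}` with critical point
sent to `j(κ)` and `j(a)` in the range. Pulling this back along `j` gives the same below `κ`, which
is supercompactness for `l` and `a`.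

From 2 to 3. Putting ordinals below `κ` in the range shows that `κ` is a limit of `Σₙ₊₁`-correct
ordinals, hence correct. For `l > κ` in `C⁽ⁿ⁾`, take a reflecting `L > l` and `j : V_{l'} → V_L`
with critical point `d`, `j(d) = κ` and `j(m) = l`. Then `j` restricted to `V_m` shows that `V_m`
embeds in a `Σₙ`-correct level with critical point `d` sent to an element of `C⁽ⁿ⁾` above `m`. This
is a `Σₙ₊₁` statement about `d` and `m`; it descends to the `Σₙ₊₁`-correct `V_{l'}`, moves along `j`
to `V_L`, and there says what is wanted of `κ` and `l`. From 3 to 1 there is nothing to do.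

The labour lies in the complexity bounds. Satisfaction relations for set structures are described by
a `Δ₀` condition (`SatT`, `ElemT`), being a level by a `Π₁` condition (`IsHier`), and
`Σₙ`-correctness by a `Πₙ` condition (`ITT`, `itt_iff`). These give `Del.localRefl` for the first
implication and `sigD_globalExt` for the second. -/

namespace PredSet

open FirstOrder FirstOrder.Language

/-! ### De Bruijn formulas and satisfaction in classes of sets -/

/-- Formulas of the language `{∈, P}` with de Bruijn indices. -/
inductive Fm : Type
  | eq (i j : ℕ) : Fm
  | mem (i j : ℕ) : Fm
  | pred (i : ℕ) : Fm
  | bot : Fm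
  | imp (φ ψ : Fm) : Fm
  | all (φ : Fm) : Fm

/-- Extend an assignment by a new value for the variable `0`. -/
def push (x : ZFSet.{u}) (v : ℕ → ZFSet.{u}) : ℕ → ZFSet.{u}
  | 0 => x
  | i + 1 => v i

@[simp] theorem push_zero (x : ZFSet.{u}) (v : ℕ → ZFSet.{u}) : push x v 0 = x := rfl

@[simp] theorem push_succ (x : ZFSet.{u}) (v : ℕ → ZFSet.{u}) (i : ℕ) :
    push x v (i + 1) = v i := rfl

theorem push_mem {M : Set ZFSet.{u}} {x : ZFSet.{u}} {v : ℕ → ZFSet.{u}} (hx : x ∈ M)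
    (hv : ∀ i, v i ∈ M) : ∀ i, push x v i ∈ M
  | 0 => hx
  | i + 1 => hv i

theorem comp_push (f : ZFSet.{u} → ZFSet.{u}) (x : ZFSet.{u}) (v : ℕ → ZFSet.{u}) :
    (fun i => f (push x v i)) = push (f x) (fun i => f (v i)) := by
  funext i; cases i <;> rfl

/-- Satisfaction of a formula in the structure `⟨M, ∈, P ∩ M⟩`. -/
def Sat (P : Class.{u}) (M : Set ZFSet.{u}) : (ℕ → ZFSet.{u}) → Fm → Prop
  | v, .eq i j => v i = v j
  | v, .mem i j => v i ∈ v j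
  | v, .pred i => P (v i)
  | _, .bot => False
  | v, .imp φ ψ => Sat P M v φ → Sat P M v ψ
  | v, .all φ => ∀ x ∈ M, Sat P M (push x v) φ

/-- Lift a renaming under a quantifier. -/
def up (f : ℕ → ℕ) : ℕ → ℕ
  | 0 => 0
  | i + 1 => f i + 1

/-- Renaming of the variables. -/
def Fm.ren : (ℕ → ℕ) → Fm → Fm
  | f, .eq i j => .eq (f i) (f j)
  | f, .mem i j => .mem (f i) (f j)
  | f, .pred i => .pred (f i)
  | _, .bot => .bot
  | f, .imp φ ψ => .imp (φ.ren f) (ψ.ren f)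
  | f, .all φ => .all (φ.ren (up f))

/-- Negation. -/
def Fm.neg (φ : Fm) : Fm := φ.imp .bot

/-- Existential quantification. -/
def Fm.ex (φ : Fm) : Fm := φ.neg.all.neg

/-- Bounded universal quantification. -/
def Fm.ball (t : ℕ) (φ : Fm) : Fm := ((Fm.mem 0 (t + 1)).imp φ).all

section
variable {P : Class.{u}} {M : Set ZFSet.{u}}

theorem sat_ren (φ : Fm) (f : ℕ → ℕ) (v : ℕ → ZFSet.{u}) :
    Sat P M v (φ.ren f) ↔ Sat P M (fun i => v (f i)) φ := by
  induction φ generalizing f v with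
  | eq i j => rfl
  | mem i j => rfl
  | pred i => rfl
  | bot => rfl
  | imp φ ψ h1 h2 => simp [Fm.ren, Sat, h1, h2]
  | all φ h =>
    simp only [Fm.ren, Sat, h]
    refine forall₂_congr fun x _ => ?_
    have : (fun i => push x v (up f i)) = push x (fun i => v (f i)) := by
      funext i; cases i <;> rfl
    rw [this]

@[simp] theorem sat_neg (φ : Fm) (v : ℕ → ZFSet.{u}) : Sat P M v φ.neg ↔ ¬ Sat P M v φ := by
  simp [Fm.neg, Sat]

@[simp] theorem sat_ex (φ : Fm) (v : ℕ → ZFSet.{u}) :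
    Sat P M v φ.ex ↔ ∃ x ∈ M, Sat P M (push x v) φ := by
  simp [Fm.ex, Sat]

theorem sat_ball (t : ℕ) (φ : Fm) (v : ℕ → ZFSet.{u}) :
    Sat P M v (.ball t φ) ↔ ∀ x ∈ M, x ∈ v t → Sat P M (push x v) φ := Iff.rfl

/-- The truth value of a formula depends on finitely many variables only. -/
theorem exists_support (φ : Fm) : ∃ N : ℕ, ∀ (P : Class.{u}) (M : Set ZFSet.{u})
    (v w : ℕ → ZFSet.{u}), (∀ i < N, v i = w i) → (Sat P M v φ ↔ Sat P M w φ) := by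
  induction φ with
  | eq i j => exact ⟨i + j + 1, fun P M v w h => by
      simp [Sat, h i (by omega), h j (by omega)]⟩
  | mem i j => exact ⟨i + j + 1, fun P M v w h => by
      simp [Sat, h i (by omega), h j (by omega)]⟩
  | pred i => exact ⟨i + 1, fun P M v w h => by simp [Sat, h i (by omega)]⟩
  | bot => exact ⟨0, fun P M v w h => Iff.rfl⟩
  | imp φ ψ h1 h2 =>
    obtain ⟨n, h1⟩ := h1
    obtain ⟨m, h2⟩ := h2
    exact ⟨n + m, fun P M v w h => by
      simp only [Sat, h1 P M v w (fun i hi => h i (by omega)),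
        h2 P M v w (fun i hi => h i (by omega))]⟩
  | all φ h1 =>
    obtain ⟨n, h1⟩ := h1
    refine ⟨n, fun P M v w h => forall₂_congr fun x _ => h1 P M _ _ fun i hi => ?_⟩
    cases i with
    | zero => rfl
    | succ i => exact h i (by omega)

end

/-! ### The Lévy hierarchy and translation between the two syntaxes -/

/-- `Δ₀` formulas. -/
inductive FDelta : Fm → Prop
  | eq (i j : ℕ) : FDelta (.eq i j)
  | mem (i j : ℕ) : FDelta (.mem i j)
  | pred (i : ℕ) : FDelta (.pred i)
  | bot : FDelta .bot
  | imp {φ ψ : Fm} : FDelta φ → FDelta ψ → FDelta (.imp φ ψ)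
  | ball (t : ℕ) {φ : Fm} : FDelta φ → FDelta (.ball t φ)

/-- `Σₙ` formulas. -/
inductive FSigma : ℕ → Fm → Prop
  | delta {n : ℕ} {φ : Fm} : FDelta φ → FSigma n φ
  | neg {n : ℕ} {φ : Fm} : FSigma n φ → FSigma (n + 1) φ.neg
  | ex {n : ℕ} {φ : Fm} : FSigma (n + 1) φ → FSigma (n + 1) φ.ex

theorem FDelta.ren {φ : Fm} (h : FDelta φ) : ∀ f : ℕ → ℕ, FDelta (φ.ren f) := by
  induction h with
  | eq i j => exact fun f => .eq _ _
  | mem i j => exact fun f => .mem _ _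
  | pred i => exact fun f => .pred _
  | bot => exact fun f => .bot
  | imp _ _ h1 h2 => exact fun f => .imp (h1 f) (h2 f)
  | ball t _ h => exact fun f => .ball (f t) (h (up f))

theorem FSigma.ren {n : ℕ} {φ : Fm} (h : FSigma n φ) : ∀ f : ℕ → ℕ, FSigma n (φ.ren f) := by
  induction h with
  | delta h => exact fun f => .delta (h.ren f)
  | neg _ h => exact fun f => .neg (h f)
  | ex _ h => exact fun f => .ex (h (up f))

theorem FSigma.succ {n : ℕ} {φ : Fm} (h : FSigma n φ) : FSigma (n + 1) φ := by
  induction h with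
  | delta h => exact .delta h
  | neg _ h => exact .neg h
  | ex _ h => exact .ex h

theorem FSigma.mono {n m : ℕ} (hnm : n ≤ m) {φ : Fm} (h : FSigma n φ) : FSigma m φ := by
  induction hnm with
  | refl => exact h
  | step _ ih => exact ih.succ

/-- The variable of a term. -/
def termVar {γ : Type} : Lang.Term γ → γ
  | .var x => x
  | .func f _ => Empty.elim f

/-- Atomic formulas for the relation symbols. -/
def relFm : ∀ {l : ℕ}, Rel l → (Fin l → ℕ) → Fm
  | _, .mem, t => .mem (t 0) (t 1)
  | _, .pred, t => .pred (t 0)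

/-- Extend a numbering of the free variables by one bound variable. -/
def extVar {γ : Type} {k : ℕ} (e : γ ⊕ Fin k → ℕ) : γ ⊕ Fin (k + 1) → ℕ
  | .inl g => e (.inl g) + 1
  | .inr j => Fin.lastCases (motive := fun _ => ℕ) 0 (fun j => e (.inr j) + 1) j

/-- Translation of first-order formulas into de Bruijn formulas. -/
def toFm {γ : Type} : ∀ {k : ℕ}, (γ ⊕ Fin k → ℕ) → Lang.BoundedFormula γ k → Fm
  | _, _, .falsum => .bot
  | _, e, .equal s t => .eq (e (termVar s)) (e (termVar t))
  | _, e, .rel R ts => relFm R (fun i => e (termVar (ts i)))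
  | _, e, .imp φ ψ => .imp (toFm e φ) (toFm e ψ)
  | _, e, .all φ => .all (toFm (extVar e) φ)

/-- Extend an interpretation of de Bruijn indices under a quantifier. -/
def extIdx {γ : Type} {k : ℕ} (e : ℕ → γ ⊕ Fin k) : ℕ → γ ⊕ Fin (k + 1)
  | 0 => .inr (Fin.last k)
  | i + 1 => Sum.map id Fin.castSucc (e i)

/-- Translation of de Bruijn formulas into first-order formulas. -/
def ofFm {γ : Type} : ∀ {k : ℕ}, (ℕ → γ ⊕ Fin k) → Fm → Lang.BoundedFormula γ k
  | _, e, .eq i j => .equal (.var (e i)) (.var (e j))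
  | _, e, .mem i j => memF (.var (e i)) (.var (e j))
  | _, e, .pred i => predF (.var (e i))
  | _, _, .bot => .falsum
  | _, e, .imp φ ψ => .imp (ofFm e φ) (ofFm e ψ)
  | _, e, .all φ => .all (ofFm (extIdx e) φ)

theorem eq_var_termVar {γ : Type} (t : Lang.Term γ) : t = .var (termVar t) := by
  cases t with
  | var x => rfl
  | func f _ => exact Empty.elim f

theorem FDelta.ofFm {γ : Type} {φ : Fm} (h : FDelta φ) :
    ∀ {k : ℕ} (e : ℕ → γ ⊕ Fin k), IsDeltaZero (ofFm e φ) := by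
  induction h with
  | eq i j => exact fun e => .equal _ _
  | mem i j => exact fun e => .mem _ _
  | pred i => exact fun e => .pred _
  | bot => exact fun e => .falsum
  | imp _ _ h1 h2 => exact fun e => .imp (h1 e) (h2 e)
  | ball t _ h => exact fun e => .ball (.var (e t)) (h (extIdx e))

theorem FSigma.ofFm {γ : Type} {n : ℕ} {φ : Fm} (h : FSigma n φ) :
    ∀ {k : ℕ} (e : ℕ → γ ⊕ Fin k), IsSigma n (ofFm e φ) := by
  induction h with
  | delta h => exact fun e => .delta (h.ofFm e)
  | neg _ h => exact fun e => .neg (h e)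
  | ex _ h => exact fun e => .ex (h (extIdx e))

theorem IsDeltaZero.toFm {γ : Type} {k : ℕ} {φ : Lang.BoundedFormula γ k} (h : IsDeltaZero φ) :
    ∀ e : γ ⊕ Fin k → ℕ, FDelta (toFm e φ) := by
  induction h with
  | falsum => exact fun e => .bot
  | equal s t => exact fun e => .eq _ _
  | mem s t => exact fun e => .mem _ _
  | pred t => exact fun e => .pred _
  | imp _ _ h1 h2 => exact fun e => .imp (h1 e) (h2 e)
  | @ball k t φ _ h =>
    intro e
    -- The quantified variable gets index `0` and every other index is shifted by one, so the guard
    -- becomes exactly that of `Fm.ball`.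
    have : PredSet.toFm e (ballF t φ) = .ball (e (termVar t)) (PredSet.toFm (extVar e) φ) := by
      rw [eq_var_termVar t]
      generalize termVar t = x
      have h0 : extVar e (.inr (Fin.last k)) = 0 := by simp [extVar]
      have h1 : extVar e (Sum.map id Fin.castSucc x) = e x + 1 := by
        cases x <;> simp [extVar]
      change Fm.all (Fm.imp (Fm.mem (extVar e (.inr (Fin.last k)))
        (extVar e (Sum.map id Fin.castSucc x))) _) = _
      rw [h0, h1]
      rfl
    rw [this]
    exact .ball _ (h _)

theorem IsSigma.toFm {γ : Type} {n k : ℕ} {φ : Lang.BoundedFormula γ k} (h : IsSigma n φ) :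
    ∀ e : γ ⊕ Fin k → ℕ, FSigma n (toFm e φ) := by
  induction h with
  | delta h => exact fun e => .delta (h.toFm e)
  | neg _ h => exact fun e => .neg (h e)
  | ex _ h => exact fun e => .ex (h (extVar e))

/-- `ι` identifies the structure `N` with `⟨M, ∈, P ∩ M⟩`. -/
structure Interp (P : Class.{u}) {N : Type (u + 1)} [Lang.Structure N] (ι : N → ZFSet.{u})
    (M : Set ZFSet.{u}) : Prop where
  inj : Function.Injective ι
  mem : ∀ x : Fin 2 → N, Structure.RelMap memSym x ↔ ι (x 0) ∈ ι (x 1)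
  pred : ∀ x : Fin 1 → N, Structure.RelMap predSym x ↔ P (ι (x 0))
  range : ∀ x, x ∈ M ↔ ∃ y, ι y = x

theorem Interp.level (P : Class.{u}) (a : Ordinal.{u}) :
    Interp P (Level.toSet : Level P a → ZFSet.{u}) (ZFSet.vonNeumann a : Set ZFSet.{u}) where
  inj := fun _ _ h => Subtype.ext h
  mem := fun _ => Iff.rfl
  pred := fun _ => Iff.rfl
  range := fun x => ⟨fun h => ⟨⟨x, h⟩, rfl⟩, fun ⟨y, h⟩ => h ▸ y.2⟩

theorem Interp.universe (P : Class.{u}) :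
    Interp P (Universe.toSet : Universe P → ZFSet.{u}) Set.univ where
  inj := fun _ _ h => h
  mem := fun _ => Iff.rfl
  pred := fun _ => Iff.rfl
  range := fun x => ⟨fun _ => ⟨x, rfl⟩, fun _ => trivial⟩

section
variable {P : Class.{u}} {N : Type (u + 1)} [Lang.Structure N] {ι : N → ZFSet.{u}}
  {M : Set ZFSet.{u}} {γ : Type}

theorem realize_eq {k : ℕ} (t : Lang.Term (γ ⊕ Fin k)) (v : γ → N) (xs : Fin k → N) :
    t.realize (Sum.elim v xs) = Sum.elim v xs (termVar t) := by
  conv_lhs => rw [eq_var_termVar t]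
  rfl

theorem Interp.relMap (H : Interp P ι M) : ∀ {l : ℕ} (R : Rel l) (x : Fin l → N) (ts : Fin l → ℕ)
    (w : ℕ → ZFSet.{u}), (∀ i, w (ts i) = ι (x i)) →
      (Structure.RelMap (L := Lang) (M := N) (n := l) R x ↔ Sat P M w (relFm R ts))
  | _, .mem, x, ts, w, h => (H.mem x).trans (by simp [relFm, Sat, h])
  | _, .pred, x, ts, w, h => (H.pred x).trans (by simp [relFm, Sat, h])

theorem Interp.realize_toFm (H : Interp P ι M) {k : ℕ} (φ : Lang.BoundedFormula γ k) :
    ∀ (e : γ ⊕ Fin k → ℕ) (v : γ → N) (xs : Fin k → N) (w : ℕ → ZFSet.{u}),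
      (∀ i, w (e i) = ι (Sum.elim v xs i)) → (φ.Realize v xs ↔ Sat P M w (toFm e φ)) := by
  induction φ with
  | falsum => exact fun _ _ _ _ _ => Iff.rfl
  | equal s t =>
    intro e v xs w h
    simp only [BoundedFormula.Realize, toFm, Sat, h, realize_eq, H.inj.eq_iff]
  | rel R ts =>
    intro e v xs w h
    simp only [BoundedFormula.Realize, toFm, realize_eq]
    exact H.relMap R _ _ _ fun i => h _
  | imp φ ψ h1 h2 =>
    intro e v xs w h
    simp only [BoundedFormula.Realize, toFm, Sat, h1 e v xs w h, h2 e v xs w h]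
  | all φ ih =>
    intro e v xs w h
    have key : ∀ a : N, φ.Realize v (Fin.snoc xs a) ↔ Sat P M (push (ι a) w) (toFm (extVar e) φ) := by
      refine fun a => ih _ _ _ _ ?_
      rintro (g | j)
      · simpa [extVar] using h (.inl g)
      · induction j using Fin.lastCases with
        | last => simp [extVar]
        | cast j => simpa [extVar] using h (.inr j)
    simp only [BoundedFormula.Realize, toFm, Sat, H.range]
    constructor
    · rintro h _ ⟨y, rfl⟩
      exact (key y).1 (h y)
    · exact fun h y => (key y).2 (h _ ⟨y, rfl⟩)

theorem Interp.realize_ofFm (H : Interp P ι M) (φ : Fm) :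
    ∀ {k : ℕ} (e : ℕ → γ ⊕ Fin k) (v : γ → N) (xs : Fin k → N) (w : ℕ → ZFSet.{u}),
      (∀ i, w i = ι (Sum.elim v xs (e i))) → ((ofFm e φ).Realize v xs ↔ Sat P M w φ) := by
  induction φ with
  | eq i j =>
    intro k e v xs w h
    simp only [ofFm, BoundedFormula.Realize, Sat, h, realize_eq, H.inj.eq_iff, termVar]
  | mem i j =>
    intro k e v xs w h
    simp only [ofFm, memF, Sat, h]
    rw [BoundedFormula.realize_rel₂]
    exact (H.mem _).trans (by simp)
  | pred i =>
    intro k e v xs w h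
    simp only [ofFm, predF, Sat, h]
    rw [BoundedFormula.realize_rel₁]
    exact (H.pred _).trans (by simp)
  | bot => exact fun _ _ _ _ _ => Iff.rfl
  | imp φ ψ h1 h2 =>
    intro k e v xs w h
    simp only [ofFm, BoundedFormula.Realize, Sat, h1 e v xs w h, h2 e v xs w h]
  | all φ ih =>
    intro k e v xs w h
    have key : ∀ a : N, (ofFm (extIdx e) φ).Realize v (Fin.snoc xs a) ↔
        Sat P M (push (ι a) w) φ := by
      refine fun a => ih _ _ _ _ ?_
      rintro (_ | i)
      · simp [extIdx]
      · rw [push_succ, h]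
        simp only [extIdx]
        cases e i <;> simp
    simp only [BoundedFormula.Realize, ofFm, Sat, H.range]
    constructor
    · rintro h _ ⟨y, rfl⟩
      exact (key y).1 (h y)
    · exact fun h y => (key y).2 (h _ ⟨y, rfl⟩)

end

/-! ### Correctness and elementarity in terms of de Bruijn formulas -/

/-- Bounds all variables by `N`. -/
def clamp (N : ℕ) (i : ℕ) : Fin (N + 1) ⊕ Fin 0 := .inl ⟨min i N, by omega⟩

/-- Every de Bruijn formula is equivalent to a formula with finitely many free variables. -/
theorem exists_clamp (φ : Fm) : ∃ N : ℕ, ∀ {P : Class.{u}} {S : Type (u + 1)} [Lang.Structure S]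
    {ι : S → ZFSet.{u}} {M : Set ZFSet.{u}}, Interp P ι M → ∀ x : ℕ → S,
      (Formula.Realize (ofFm (clamp N) φ : Lang.Formula (Fin (N + 1))) (fun i => x i.1) ↔
        Sat P M (fun i => ι (x i)) φ) := by
  obtain ⟨N, hN⟩ := exists_support.{u} φ
  refine ⟨N, fun {P S _ ι M} H x => ?_⟩
  rw [hN P M _ (fun i => ι (x (min i N)))]
  · exact H.realize_ofFm φ _ _ _ _ fun i => rfl
  · intro i hi; simp [min_eq_left hi.le]

theorem Correct.sat_iff {P : Class.{u}} {n : ℕ} {a : Ordinal.{u}} (ha : a ∈ Correct P n)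
    {φ : Fm} (hφ : FSigma n φ) {v : ℕ → ZFSet.{u}} (hv : ∀ i, v i ∈ ZFSet.vonNeumann a) :
    Sat P (ZFSet.vonNeumann a : Set ZFSet.{u}) v φ ↔ Sat P Set.univ v φ := by
  obtain ⟨N, hN⟩ := exists_clamp.{u} φ
  let x : ℕ → Level P a := fun i => ⟨v i, hv i⟩
  have h := ha (N + 1) (ofFm (clamp N) φ) (hφ.ofFm _) (fun i => x i)
  exact ((hN (Interp.level P a) x).symm.trans h).trans
    (hN (Interp.universe P) (fun i => (x i).incl))

/-- The numbering of the variables of a formula with free variables in `Fin m`. -/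
def finVar (m : ℕ) : Fin m ⊕ Fin 0 → ℕ := Sum.elim Fin.val Fin.elim0

theorem Interp.realize_finVar {P : Class.{u}} {N : Type (u + 1)} [Lang.Structure N]
    {ι : N → ZFSet.{u}} {M : Set ZFSet.{u}} (H : Interp P ι M) {m : ℕ} (φ : Lang.Formula (Fin m))
    (x : Fin m → N) (w : ℕ → ZFSet.{u}) (hw : ∀ i : Fin m, w i = ι (x i)) :
    φ.Realize x ↔ Sat P M w (toFm (finVar m) φ) := by
  refine H.realize_toFm φ _ _ _ _ ?_
  rintro (i | i)
  · exact hw i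
  · exact i.elim0

theorem correct_of_sat_iff {P : Class.{u}} {n : ℕ} {a : Ordinal.{u}} (h0 : 0 < a)
    (h : ∀ φ : Fm, FSigma n φ → ∀ v : ℕ → ZFSet.{u}, (∀ i, v i ∈ ZFSet.vonNeumann a) →
      (Sat P (ZFSet.vonNeumann a : Set ZFSet.{u}) v φ ↔ Sat P Set.univ v φ)) :
    a ∈ Correct P n := by
  intro m φ hφ v
  -- Indices from `m` on carry the default value `∅`, which lies in `V_a` because `0 < a`.
  let w : ℕ → ZFSet.{u} := fun i => if hi : i < m then (v ⟨i, hi⟩).1 else ∅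
  have hw : ∀ i, w i ∈ ZFSet.vonNeumann a := by
    intro i
    by_cases hi : i < m
    · simpa [w, hi] using (v ⟨i, hi⟩).2
    · simpa [w, hi, ZFSet.mem_vonNeumann] using h0
  rw [(Interp.level P a).realize_finVar φ v w (fun i => by simp [w]; rfl),
    (Interp.universe P).realize_finVar φ (fun i => (v i).incl) w (fun i => by simp [w]; rfl)]
  exact h _ (hφ.toFm _) w hw

theorem elementary_sat_iff {P : Class.{u}} {l t : Ordinal.{u}} (j : Level P l ↪ₑ[Lang] Level P t)
    (φ : Fm) (v : ℕ → Level P l) :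
    Sat P (ZFSet.vonNeumann l : Set ZFSet.{u}) (fun i => (v i).toSet) φ ↔
      Sat P (ZFSet.vonNeumann t : Set ZFSet.{u}) (fun i => (j (v i)).toSet) φ := by
  obtain ⟨N, hN⟩ := exists_clamp.{u} φ
  have h := j.map_formula' (ofFm (clamp N) φ) (fun i => v i)
  exact ((hN (Interp.level P l) v).symm.trans h.symm).trans
    (hN (Interp.level P t) (fun i => j (v i)))

theorem exists_elementary {P : Class.{u}} {l t : Ordinal.{u}} (h0 : 0 < l)
    (f : ZFSet.{u} → ZFSet.{u}) (hf : ∀ x ∈ ZFSet.vonNeumann l, f x ∈ ZFSet.vonNeumann t)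
    (h : ∀ (φ : Fm) (v : ℕ → ZFSet.{u}), (∀ i, v i ∈ ZFSet.vonNeumann l) →
      (Sat P (ZFSet.vonNeumann l : Set ZFSet.{u}) v φ ↔
        Sat P (ZFSet.vonNeumann t : Set ZFSet.{u}) (fun i => f (v i)) φ)) :
    ∃ j : Level P l ↪ₑ[Lang] Level P t, ∀ x, (j x).toSet = f x.toSet := by
  refine ⟨⟨fun x => ⟨f x.1, hf _ x.2⟩, ?_⟩, fun x => rfl⟩
  intro m φ v
  let w : ℕ → ZFSet.{u} := fun i => if hi : i < m then (v ⟨i, hi⟩).1 else ∅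
  have hw : ∀ i, w i ∈ ZFSet.vonNeumann l := by
    intro i
    by_cases hi : i < m
    · simpa [w, hi] using (v ⟨i, hi⟩).2
    · simpa [w, hi, ZFSet.mem_vonNeumann] using h0
  rw [(Interp.level P l).realize_finVar φ v w (fun i => by simp [w]; rfl),
    (Interp.level P t).realize_finVar φ _ (fun i => f (w i)) (fun i => by simp [w]; rfl)]
  exact (h _ w hw).symm

theorem Correct.pos {P : Class.{u}} {n : ℕ} (hn : 1 ≤ n) {a : Ordinal.{u}}
    (ha : a ∈ Correct P n) : 0 < a := by
  rw [pos_iff_ne_zero]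
  rintro rfl
  obtain ⟨n, rfl⟩ : ∃ m, n = m + 1 := ⟨n - 1, by omega⟩
  -- The `Σ₁` sentence `∃ x, ¬ ⊥` fails in the empty structure `V_0` and holds in the universe.
  have h := ha 0 (BoundedFormula.falsum.not.ex) (.ex (.neg (.delta .falsum))) Fin.elim0
  have h1 : Formula.Realize (L := Lang) (M := Universe P) (α := Fin 0) (BoundedFormula.falsum.not.ex)
      (fun i => (Fin.elim0 i : Level P 0).incl) := by
    simp only [Formula.Realize, BoundedFormula.realize_ex, BoundedFormula.realize_not]
    exact ⟨(∅ : ZFSet), id⟩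
  have h2 := h.2 (by convert h1)
  simp only [Formula.Realize, BoundedFormula.realize_ex] at h2
  obtain ⟨x, _⟩ := h2
  exact (ZFSet.notMem_empty x.1) (by simpa using x.2)

end PredSet

namespace PredSet

/-! ### `Δ₀` definable relations -/

/-- Transitivity of a class of sets. -/
def TransClass (M : Set ZFSet.{u}) : Prop := ∀ x ∈ M, ∀ y ∈ x, y ∈ M

/-- `Δ₀` definable relations: the defining formula is absolute for all transitive classes. -/
def Del (P : Class.{u}) (R : (ℕ → ZFSet.{u}) → Prop) : Prop :=
  ∃ φ : Fm, FDelta φ ∧ ∀ M : Set ZFSet.{u}, TransClass M → ∀ v : ℕ → ZFSet.{u}, (∀ i, v i ∈ M) →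
    (Sat P M v φ ↔ R v)

namespace Del

variable {P : Class.{u}} {R S : (ℕ → ZFSet.{u}) → Prop}

theorem congr (h : Del P R) (e : ∀ v, R v ↔ S v) : Del P S := by
  obtain rfl : R = S := funext fun v => propext (e v)
  exact h

theorem eq (i j : ℕ) : Del P (fun v => v i = v j) :=
  ⟨.eq i j, .eq i j, fun _ _ _ _ => Iff.rfl⟩

theorem mem (i j : ℕ) : Del P (fun v => v i ∈ v j) :=
  ⟨.mem i j, .mem i j, fun _ _ _ _ => Iff.rfl⟩

theorem pred (i : ℕ) : Del P (fun v => P (v i)) :=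
  ⟨.pred i, .pred i, fun _ _ _ _ => Iff.rfl⟩

theorem false : Del P (fun _ => False) :=
  ⟨.bot, .bot, fun _ _ _ _ => Iff.rfl⟩

theorem imp (h1 : Del P R) (h2 : Del P S) : Del P (fun v => R v → S v) := by
  obtain ⟨φ, hφ, h1⟩ := h1
  obtain ⟨ψ, hψ, h2⟩ := h2
  exact ⟨φ.imp ψ, hφ.imp hψ, fun M hM v hv => by simp only [Sat, h1 M hM v hv, h2 M hM v hv]⟩

theorem not (h : Del P R) : Del P (fun v => ¬ R v) := h.imp false

theorem and (h1 : Del P R) (h2 : Del P S) : Del P (fun v => R v ∧ S v) :=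
  (h1.imp h2.not).not.congr fun v => by tauto

theorem or (h1 : Del P R) (h2 : Del P S) : Del P (fun v => R v ∨ S v) :=
  (h1.not.imp h2).congr fun v => by tauto

theorem iff (h1 : Del P R) (h2 : Del P S) : Del P (fun v => R v ↔ S v) :=
  ((h1.imp h2).and (h2.imp h1)).congr fun v => by tauto

theorem ball {R : (ℕ → ZFSet.{u}) → ZFSet.{u} → Prop} (t : ℕ)
    (h : Del P (fun w => R (fun i => w (i + 1)) (w 0))) : Del P (fun v => ∀ x ∈ v t, R v x) := by
  obtain ⟨φ, hφ, h⟩ := h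
  refine ⟨.ball t φ, hφ.ball t, fun M hM v hv => ?_⟩
  rw [sat_ball]
  constructor
  · exact fun H x hx => (h M hM _ (push_mem (hM _ (hv t) _ hx) hv)).1 (H x (hM _ (hv t) _ hx) hx)
  · exact fun H x hxM hx => (h M hM _ (push_mem hxM hv)).2 (H x hx)

theorem bex {R : (ℕ → ZFSet.{u}) → ZFSet.{u} → Prop} (t : ℕ)
    (h : Del P (fun w => R (fun i => w (i + 1)) (w 0))) : Del P (fun v => ∃ x ∈ v t, R v x) :=
  (ball (R := fun v x => ¬ R v x) t h.not).not.congr fun v => by simp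

theorem singleton (i j : ℕ) : Del P (fun v => v i = {v j}) := by
  refine Del.congr (R := fun v => v j ∈ v i ∧ ∀ x ∈ v i, x = v j)
    ((mem _ _).and (ball i (eq _ _))) fun v => ?_
  constructor
  · rintro ⟨h1, h2⟩
    ext x
    simp only [ZFSet.mem_singleton]
    exact ⟨h2 x, fun h => h ▸ h1⟩
  · intro h; rw [h]; simp

theorem upair (i j k : ℕ) : Del P (fun v => v i = {v j, v k}) := by
  refine Del.congr (R := fun v => v j ∈ v i ∧ v k ∈ v i ∧ ∀ x ∈ v i, x = v j ∨ x = v k)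
    ((mem _ _).and ((mem _ _).and (ball i ((eq _ _).or (eq _ _))))) fun v => ?_
  constructor
  · rintro ⟨h1, h2, h3⟩
    ext x
    simp only [ZFSet.mem_pair]
    exact ⟨h3 x, fun h => by rcases h with h | h <;> rw [h] <;> assumption⟩
  · intro h; rw [h]; simp

theorem pair (i j k : ℕ) : Del P (fun v => v i = ZFSet.pair (v j) (v k)) := by
  refine Del.congr (R := fun v => ∃ s ∈ v i, ∃ d ∈ v i, s = {v j} ∧ d = {v j, v k} ∧ v i = {s, d})
    (bex i (bex _ ((singleton _ _).and ((upair _ _ _).and (upair _ _ _))))) fun v => ?_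
  constructor
  · rintro ⟨s, _, d, _, rfl, rfl, h⟩
    exact h
  · intro h
    refine ⟨{v j}, ?_, {v j, v k}, ?_, rfl, rfl, h⟩ <;> rw [h] <;> simp [ZFSet.pair]

theorem pairMem (i j k : ℕ) : Del P (fun v => ZFSet.pair (v i) (v j) ∈ v k) :=
  Del.congr (R := fun v => ∃ p ∈ v k, p = ZFSet.pair (v i) (v j)) (bex k (pair _ _ _))
    fun v => by simp

/-- The inner pair is reached by bounded quantifiers because it belongs to an element of the outer
Kuratowski pair. -/
theorem tripleMem (i j k l : ℕ) :
    Del P (fun v => ZFSet.pair (v i) (ZFSet.pair (v j) (v k)) ∈ v l) := by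
  refine Del.congr (R := fun v => ∃ p ∈ v l, ∃ s ∈ p, ∃ q ∈ s,
    q = ZFSet.pair (v j) (v k) ∧ p = ZFSet.pair (v i) q)
    (bex l (bex _ (bex _ ((pair _ _ _).and (pair _ _ _))))) fun v => ?_
  constructor
  · rintro ⟨p, hp, s, _, q, _, rfl, rfl⟩
    exact hp
  · intro h
    refine ⟨_, h, {v i, ZFSet.pair (v j) (v k)}, ?_, _, ?_, rfl, rfl⟩
    · simp [ZFSet.pair]
    · simp

theorem subset (i j : ℕ) : Del P (fun v => v i ⊆ v j) :=
  Del.congr (R := fun v => ∀ x ∈ v i, x ∈ v j) (ball i (mem _ _)) fun _ => Iff.rfl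

theorem isTransitive (i : ℕ) : Del P (fun v => (v i).IsTransitive) :=
  Del.congr (R := fun v => ∀ x ∈ v i, x ⊆ v i) (ball i (subset _ _)) fun _ => Iff.rfl

theorem isOrdinal (i : ℕ) : Del P (fun v => (v i).IsOrdinal) :=
  Del.congr (R := fun v => (v i).IsTransitive ∧ ∀ x ∈ v i, x.IsTransitive)
    ((isTransitive i).and (ball i (isTransitive _)))
    fun _ => ZFSet.isOrdinal_iff_forall_mem_isTransitive.symm

theorem nonempty (i : ℕ) : Del P (fun v => (v i).Nonempty) :=
  Del.congr (R := fun v => ∃ x ∈ v i, x = x) (bex i (eq _ _)) fun v => by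
    simp [ZFSet.nonempty_def]

theorem insertSelf (i j : ℕ) : Del P (fun v => v i = insert (v j) (v j)) := by
  refine Del.congr (R := fun v => v j ∈ v i ∧ v j ⊆ v i ∧ ∀ x ∈ v i, x = v j ∨ x ∈ v j)
    ((mem _ _).and ((subset _ _).and (ball i ((eq _ _).or (mem _ _))))) fun v => ?_
  constructor
  · rintro ⟨h1, h2, h3⟩
    ext x
    simp only [ZFSet.mem_insert_iff]
    exact ⟨h3 x, fun h => by rcases h with h | h; exacts [h ▸ h1, h2 h]⟩
  · intro h; rw [h]; simp [ZFSet.subset_def]; tauto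

end Del

/-! ### Closure properties of `Σₙ` and `Πₙ` definability -/

/-- Conjunction or disjunction. -/
def conn (b : Bool) (p q : Prop) : Prop := if b then p ∧ q else p ∨ q

theorem conn_comm (b : Bool) (p q : Prop) : conn b p q ↔ conn b q p := by
  cases b <;> simp [conn, and_comm, or_comm]

theorem conn_not (b : Bool) (p q : Prop) : conn b (¬ p) (¬ q) ↔ ¬ conn (!b) p q := by
  cases b
  · simp [conn]; tauto
  · simp [conn]

theorem conn_exists {α : Type*} [Nonempty α] (b : Bool) (p : α → Prop) (q : Prop) :
    conn b (∃ x, p x) q ↔ ∃ x, conn b (p x) q := by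
  cases b <;> simp [conn, exists_or]

/-- Existential quantifiers are pulled out of both arguments; what remains are two negations of `Σₙ`
formulas, which De Morgan reduces to the dual connective one level down. Treating both connectives
at once makes that induction go through. The equivalence is claimed over the universe only, since
moving `∃` across `∨` needs a nonempty domain. -/
theorem exists_conn (P : Class.{u}) : ∀ (n : ℕ) (b : Bool) {φ ψ : Fm}, FSigma n φ → FSigma n ψ →
    ∃ χ, FSigma n χ ∧ ∀ v, Sat P Set.univ v χ ↔
      conn b (Sat P Set.univ v φ) (Sat P Set.univ v ψ) := by
  intro n
  induction n with
  | zero =>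
    intro b φ ψ hφ hψ
    cases hφ with
    | delta hφ =>
    cases hψ with
    | delta hψ =>
    cases b
    · exact ⟨φ.neg.imp ψ, .delta ((hφ.imp .bot).imp hψ), fun v => by
        simp [Sat, conn]; tauto⟩
    · exact ⟨(φ.imp ψ.neg).neg, .delta ((hφ.imp (hψ.imp .bot)).imp .bot), fun v => by
        simp [Sat, conn]⟩
  | succ n ih =>
    -- Here the first argument has no quantifiers left to pull out, and the induction runs over the
    -- second.
    have base : ∀ (b : Bool) {ψ : Fm}, FSigma (n + 1) ψ → ∀ φ, FSigma (n + 1) φ →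
        (∃ φ', FSigma n φ' ∧ ∀ v, Sat P Set.univ v φ ↔ ¬ Sat P Set.univ v φ') →
        ∃ χ, FSigma (n + 1) χ ∧ ∀ v, Sat P Set.univ v χ ↔
          conn b (Sat P Set.univ v φ) (Sat P Set.univ v ψ) := by
      intro b ψ hψ
      have bb : ∀ {ψ' : Fm}, FSigma n ψ' → ∀ φ, FSigma (n + 1) φ →
          (∃ φ', FSigma n φ' ∧ ∀ v, Sat P Set.univ v φ ↔ ¬ Sat P Set.univ v φ') →
          ∃ χ, FSigma (n + 1) χ ∧ ∀ v, Sat P Set.univ v χ ↔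
            conn b (Sat P Set.univ v φ) (¬ Sat P Set.univ v ψ') := by
        rintro ψ' hψ' φ hφ ⟨φ', hφ', h⟩
        obtain ⟨χ, hχ, hh⟩ := ih (!b) hφ' hψ'
        exact ⟨χ.neg, hχ.neg, fun v => by rw [sat_neg, hh, h, conn_not]⟩
      generalize hm : n + 1 = m at hψ
      induction hψ with
      | @delta m ψ hψ =>
        subst hm
        intro φ hφ h
        obtain ⟨χ, hχ, hh⟩ := bb (ψ' := ψ.neg) (.delta (hψ.imp .bot)) φ hφ h
        exact ⟨χ, hχ, fun v => by rw [hh]; simp⟩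
      | @neg m ψ hψ _ =>
        obtain rfl : n = m := by omega
        intro φ hφ h
        obtain ⟨χ, hχ, hh⟩ := bb hψ φ hφ h
        exact ⟨χ, hχ, fun v => by rw [hh]; simp⟩
      | @ex m ψ _ ih2 =>
        obtain rfl : n = m := by omega
        rintro φ hφ ⟨φ', hφ', h⟩
        -- The renaming frees the variable `0` for the quantifier that is pulled out of the other
        -- argument.
        obtain ⟨χ, hχ, hh⟩ := ih2 rfl (φ.ren Nat.succ) (hφ.ren _)
          ⟨φ'.ren Nat.succ, hφ'.ren _, fun v => by rw [sat_ren, sat_ren, h]⟩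
        refine ⟨χ.ex, hχ.ex, fun v => ?_⟩
        rw [conn_comm, sat_ex, sat_ex]
        simp only [Set.mem_univ, true_and]
        rw [conn_exists]
        refine exists_congr fun x => ?_
        rw [hh, sat_ren, conn_comm]
        rfl
    intro b φ ψ hφ
    generalize hm : n + 1 = m at hφ
    induction hφ generalizing ψ with
    | @delta m φ hφ =>
      subst hm
      intro hψ
      exact base b hψ φ (.delta hφ) ⟨φ.neg, .delta (hφ.imp .bot), fun v => by simp⟩
    | @neg m φ hφ _ =>
      obtain rfl : n = m := by omega
      intro hψ
      exact base b hψ φ.neg hφ.neg ⟨φ, hφ, fun v => by simp⟩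
    | @ex m φ _ ih2 =>
      obtain rfl : n = m := by omega
      intro hψ
      obtain ⟨χ, hχ, hh⟩ := ih2 (ψ := ψ.ren Nat.succ) rfl (hψ.ren _)
      refine ⟨χ.ex, hχ.ex, fun v => ?_⟩
      rw [sat_ex, sat_ex]
      simp only [Set.mem_univ, true_and]
      rw [conn_exists]
      refine exists_congr fun x => ?_
      rw [hh, sat_ren]
      rfl

/-- Relations on the universe definable by `Σₙ` formulas. -/
def SigD (P : Class.{u}) (n : ℕ) (R : (ℕ → ZFSet.{u}) → Prop) : Prop :=
  ∃ φ : Fm, FSigma n φ ∧ ∀ v : ℕ → ZFSet.{u}, Sat P Set.univ v φ ↔ R v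

/-- Relations on the universe definable by `Πₙ` formulas. -/
def PiD (P : Class.{u}) (n : ℕ) (R : (ℕ → ZFSet.{u}) → Prop) : Prop :=
  SigD P n (fun v => ¬ R v)

section
variable {P : Class.{u}} {R S : (ℕ → ZFSet.{u}) → Prop} {n : ℕ}

theorem SigD.congr (h : SigD P n R) (e : ∀ v, R v ↔ S v) : SigD P n S := by
  obtain rfl : R = S := funext fun v => propext (e v)
  exact h

theorem SigD.mono {m : ℕ} (hnm : n ≤ m) (h : SigD P n R) : SigD P m R := by
  obtain ⟨φ, hφ, h⟩ := h
  exact ⟨φ, hφ.mono hnm, h⟩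

theorem PiD.mono {m : ℕ} (hnm : n ≤ m) (h : PiD P n R) : PiD P m R := SigD.mono hnm h

theorem Del.sigD (h : Del P R) : SigD P n R := by
  obtain ⟨φ, hφ, h⟩ := h
  exact ⟨φ, .delta hφ, fun v => h _ (fun _ _ _ _ => trivial) v fun _ => trivial⟩

theorem Del.piD (h : Del P R) : PiD P n R := h.not.sigD

theorem PiD.sigD (h : PiD P n R) : SigD P (n + 1) R := by
  obtain ⟨φ, hφ, h⟩ := h
  exact ⟨φ.neg, hφ.neg, fun v => by rw [sat_neg, h, not_not]⟩

theorem SigD.and (h1 : SigD P n R) (h2 : SigD P n S) : SigD P n (fun v => R v ∧ S v) := by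
  obtain ⟨φ, hφ, h1⟩ := h1
  obtain ⟨ψ, hψ, h2⟩ := h2
  obtain ⟨χ, hχ, h⟩ := exists_conn P n true hφ hψ
  exact ⟨χ, hχ, fun v => by rw [h, h1, h2]; simp [conn]⟩

theorem SigD.or (h1 : SigD P n R) (h2 : SigD P n S) : SigD P n (fun v => R v ∨ S v) := by
  obtain ⟨φ, hφ, h1⟩ := h1
  obtain ⟨ψ, hψ, h2⟩ := h2
  obtain ⟨χ, hχ, h⟩ := exists_conn P n false hφ hψ
  exact ⟨χ, hχ, fun v => by rw [h, h1, h2]; simp [conn]⟩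

theorem PiD.and (h1 : PiD P n R) (h2 : PiD P n S) : PiD P n (fun v => R v ∧ S v) :=
  (SigD.or h1 h2).congr fun v => by tauto

theorem SigD.exists {R : (ℕ → ZFSet.{u}) → ZFSet.{u} → Prop}
    (h : SigD P (n + 1) (fun w => R (fun i => w (i + 1)) (w 0))) :
    SigD P (n + 1) (fun v => ∃ x, R v x) := by
  obtain ⟨φ, hφ, h⟩ := h
  refine ⟨φ.ex, hφ.ex, fun v => ?_⟩
  rw [sat_ex]
  simp only [Set.mem_univ, true_and]
  exact exists_congr fun x => h _

theorem PiD.forall {R : (ℕ → ZFSet.{u}) → ZFSet.{u} → Prop}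
    (h : PiD P (n + 1) (fun w => R (fun i => w (i + 1)) (w 0))) :
    PiD P (n + 1) (fun v => ∀ x, R v x) :=
  (SigD.exists (R := fun v x => ¬ R v x) h).congr fun v => by simp

theorem FDelta.absolute {φ : Fm} (h : FDelta φ) {M : Set ZFSet.{u}} (hM : TransClass M) :
    ∀ {v : ℕ → ZFSet.{u}}, (∀ i, v i ∈ M) → (Sat P M v φ ↔ Sat P Set.univ v φ) := by
  induction h with
  | eq i j => exact fun _ => Iff.rfl
  | mem i j => exact fun _ => Iff.rfl
  | pred i => exact fun _ => Iff.rfl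
  | bot => exact fun _ => Iff.rfl
  | imp _ _ h1 h2 => exact fun hv => by simp only [Sat, h1 hv, h2 hv]
  | ball t _ h =>
    intro v hv
    rw [sat_ball, sat_ball]
    constructor
    · exact fun H x _ hx => (h (push_mem (hM _ (hv t) _ hx) hv)).1 (H x (hM _ (hv t) _ hx) hx)
    · exact fun H x hxM hx => (h (push_mem hxM hv)).2 (H x trivial hx)

end

end PredSet

namespace PredSet

open ZFSet (vonNeumann)

/-! ### `Σₙ`-correct transitive classes -/

/-- `M` is a transitive class and `⟨M, ∈, P ∩ M⟩` is a `Σₙ`-elementary substructure of the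
universe. -/
def TT (P : Class.{u}) (n : ℕ) (M : Set ZFSet.{u}) : Prop :=
  TransClass M ∧ ∀ φ : Fm, FSigma n φ → ∀ v : ℕ → ZFSet.{u}, (∀ i, v i ∈ M) →
    (Sat P M v φ ↔ Sat P Set.univ v φ)

section
variable {P : Class.{u}} {n : ℕ} {M N : Set ZFSet.{u}}

theorem TT.mono {m : ℕ} (hmn : m ≤ n) (h : TT P n M) : TT P m M :=
  ⟨h.1, fun φ hφ => h.2 φ (hφ.mono hmn)⟩

theorem TT.univ (P : Class.{u}) (n : ℕ) : TT P n Set.univ :=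
  ⟨fun _ _ _ _ => trivial, fun _ _ _ _ => Iff.rfl⟩

theorem TT.zero_iff : TT P 0 M ↔ TransClass M :=
  ⟨fun h => h.1, fun h => ⟨h, fun φ hφ v hv => by
    cases hφ with
    | delta hφ => exact hφ.absolute h hv⟩⟩

/-- `Σₙ₊₁` formulas go up between `Σₙ`-correct classes. -/
theorem TT.upward (hM : TT P n M) (hN : TT P n N) (hMN : M ⊆ N) {φ : Fm} (hφ : FSigma (n + 1) φ) :
    ∀ {v : ℕ → ZFSet.{u}}, (∀ i, v i ∈ M) → Sat P M v φ → Sat P N v φ := by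
  generalize hm : n + 1 = m at hφ
  induction hφ with
  | delta h =>
    intro v hv
    rw [h.absolute hM.1 hv, h.absolute hN.1 fun i => hMN (hv i)]
    exact id
  | @neg m φ h _ =>
    obtain rfl : n = m := by omega
    intro v hv
    rw [sat_neg, sat_neg, hM.2 _ h _ hv, hN.2 _ h _ fun i => hMN (hv i)]
    exact id
  | ex _ ih =>
    intro v hv
    rw [sat_ex, sat_ex]
    rintro ⟨x, hx, h⟩
    exact ⟨x, hMN hx, ih hm (push_mem hx hv) h⟩

/-- A `Σₙ₊₁` formula goes up from `M` to `N` and from `N` to the universe, and the correctness of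
`M` brings it back down. This comparison is used throughout. -/
theorem TT.between (hM : TT P (n + 1) M) (hN : TT P n N) (hMN : M ⊆ N) {φ : Fm}
    (hφ : FSigma (n + 1) φ) {v : ℕ → ZFSet.{u}} (hv : ∀ i, v i ∈ M) :
    Sat P M v φ ↔ Sat P N v φ :=
  ⟨(hM.mono n.le_succ).upward hN hMN hφ hv, fun h => (hM.2 φ hφ v hv).2
    (hN.upward (.univ P n) (Set.subset_univ _) hφ (fun i => hMN (hv i)) h)⟩

theorem transClass_vonNeumann (a : Ordinal.{u}) : TransClass (vonNeumann a : Set ZFSet.{u}) :=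
  fun x hx _ hy => ZFSet.isTransitive_vonNeumann a x hx hy

theorem Correct.tt {a : Ordinal.{u}} (h : a ∈ Correct P n) :
    TT P n (vonNeumann a : Set ZFSet.{u}) :=
  ⟨transClass_vonNeumann a, fun _ hφ _ hv => Correct.sat_iff h hφ hv⟩

theorem TT.correct {a : Ordinal.{u}} (h0 : 0 < a) (h : TT P n (vonNeumann a : Set ZFSet.{u})) :
    a ∈ Correct P n :=
  correct_of_sat_iff h0 h.2

end

/-! ### Coding of formulas and the reflection theorem -/

/-- A coding of formulas by natural numbers. -/
def Fm.code : Fm → ℕ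
  | .eq i j => 6 * Nat.pair i j
  | .mem i j => 6 * Nat.pair i j + 1
  | .pred i => 6 * i + 2
  | .bot => 3
  | .imp φ ψ => 6 * Nat.pair φ.code ψ.code + 4
  | .all φ => 6 * φ.code + 5

theorem Fm.code_injective : Function.Injective Fm.code := by
  intro φ
  induction φ with
  | eq i j =>
    intro ψ h
    cases ψ with
    | eq k l =>
      simp only [Fm.code] at h
      simpa using Nat.pair_eq_pair.1 (by omega : Nat.pair i j = Nat.pair k l)
    | _ => simp only [Fm.code] at h; omega
  | mem i j =>
    intro ψ h
    cases ψ with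
    | mem k l =>
      simp only [Fm.code] at h
      simpa using Nat.pair_eq_pair.1 (by omega : Nat.pair i j = Nat.pair k l)
    | _ => simp only [Fm.code] at h; omega
  | pred i =>
    intro ψ h
    cases ψ with
    | pred k =>
      simp only [Fm.code] at h
      rw [(by omega : i = k)]
    | _ => simp only [Fm.code] at h; omega
  | bot =>
    intro ψ h
    cases ψ with
    | bot => rfl
    | _ => simp only [Fm.code] at h; omega
  | imp φ1 φ2 h1 h2 =>
    intro ψ h
    cases ψ with
    | imp ψ1 ψ2 =>
      simp only [Fm.code] at h
      have := Nat.pair_eq_pair.1 (by omega : Nat.pair φ1.code φ2.code = Nat.pair ψ1.code ψ2.code)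
      rw [h1 this.1, h2 this.2]
    | _ => simp only [Fm.code] at h; omega
  | all φ h1 =>
    intro ψ h
    cases ψ with
    | all ψ =>
      simp only [Fm.code] at h
      rw [h1 (by omega : φ.code = ψ.code)]
    | _ => simp only [Fm.code] at h; omega

/-- Countability makes suprema and sets indexed by formulas small. -/
instance : Countable Fm := Fm.code_injective.countable

/-- The rank bound for a witness against `∀ x, φ(x, v)`. -/
noncomputable def witness (P : Class.{u}) (φ : Fm) (v : ℕ → ZFSet.{u}) : Ordinal.{u} :=
  open Classical in
  if h : ∃ x, ¬ Sat P Set.univ (push x v) φ then Order.succ h.choose.rank else 0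

theorem exists_rank_lt_witness {P : Class.{u}} {φ : Fm} {v : ℕ → ZFSet.{u}}
    (h : ∃ x, ¬ Sat P Set.univ (push x v) φ) :
    ∃ x, x.rank < witness P φ v ∧ ¬ Sat P Set.univ (push x v) φ := by
  refine ⟨h.choose, ?_, h.choose_spec⟩
  rw [witness, dif_pos h]
  exact Order.lt_succ _

/-- One step of the reflection argument. -/
noncomputable def reflStep (P : Class.{u}) (a : Ordinal.{u}) : Ordinal.{u} :=
  max (Order.succ a.card).ord
    (⨆ p : Fm × (ℕ → (vonNeumann a : ZFSet.{u})), witness P p.1 fun i => (p.2 i).1)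

/-- The reflection theorem: the cardinals `c` such that `⟨V_c, ∈, P ∩ V_c⟩` is an elementary
substructure of the universe are unbounded. -/
theorem exists_reflecting (P : Class.{u}) (a : Ordinal.{u}) : ∃ c : Cardinal.{u}, a < c.ord ∧
    ∀ (φ : Fm) (v : ℕ → ZFSet.{u}), (∀ i, v i ∈ vonNeumann c.ord) →
      (Sat P (vonNeumann c.ord : Set ZFSet.{u}) v φ ↔ Sat P Set.univ v φ) := by
  let s : ℕ → Ordinal.{u} := fun k => (reflStep P)^[k] (Order.succ a)
  have hs : ∀ k, s (k + 1) = reflStep P (s k) := fun k => Function.iterate_succ_apply' _ _ _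
  have hcard : ∀ k, (Order.succ (s k).card).ord ≤ s (k + 1) := fun k => by
    rw [hs]; exact le_max_left _ _
  have hlt : ∀ k, s k < s (k + 1) := fun k =>
    lt_of_lt_of_le (Cardinal.lt_ord.2 (Order.lt_succ _)) (hcard k)
  have hmono : StrictMono s := strictMono_nat_of_lt_succ hlt
  set b : Ordinal.{u} := ⨆ k, s k
  have hsb : ∀ k, s k < b := fun k =>
    (hlt k).trans_le (le_ciSup (f := s) Ordinal.bddAbove_of_small (k + 1))
  have hb : ∀ {x}, x < b → ∃ k, x < s k := fun {x} hx => by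
    by_contra! h
    exact absurd (ciSup_le h) (not_le.2 hx)
  -- Each stage passes the successor cardinal of the one before, so every `x < b` has cardinality
  -- below that of `b`.
  have hbc : b.card.ord = b := by
    refine le_antisymm (Cardinal.ord_card_le b) (le_of_forall_lt fun x hx => ?_)
    obtain ⟨k, hk⟩ := hb hx
    rw [Cardinal.lt_ord]
    have h1 : (Order.succ (s k).card) ≤ b.card := by
      have := Ordinal.card_le_card ((hcard k).trans (hsb (k + 1)).le)
      rwa [Cardinal.card_ord] at this
    exact (Ordinal.card_le_card hk.le).trans_lt ((Order.lt_succ _).trans_le h1)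
  refine ⟨b.card, ?_, ?_⟩
  · rw [hbc]; exact (Order.lt_succ a).trans (hsb 0)
  rw [hbc]
  have hfin : ∀ (v : ℕ → ZFSet.{u}), (∀ i, v i ∈ vonNeumann b) → ∀ N : ℕ, ∃ k, ∀ i ≤ N,
      v i ∈ vonNeumann (s k) := by
    intro v hv N
    induction N with
    | zero =>
      obtain ⟨k, hk⟩ := hb (ZFSet.mem_vonNeumann.1 (hv 0))
      exact ⟨k, fun i hi => by
        obtain rfl : i = 0 := by omega
        exact ZFSet.mem_vonNeumann.2 hk⟩
    | succ N ih =>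
      obtain ⟨k, hk⟩ := ih
      obtain ⟨m, hm⟩ := hb (ZFSet.mem_vonNeumann.1 (hv (N + 1)))
      refine ⟨max k m, fun i hi => ?_⟩
      rcases hi.lt_or_eq with h | rfl
      · exact ZFSet.vonNeumann_subset_of_le (hmono.monotone (le_max_left k m)) (hk i (by omega))
      · exact ZFSet.vonNeumann_subset_of_le (hmono.monotone (le_max_right k m))
          (ZFSet.mem_vonNeumann.2 hm)
  intro φ
  induction φ with
  | eq i j => exact fun _ _ => Iff.rfl
  | mem i j => exact fun _ _ => Iff.rfl
  | pred i => exact fun _ _ => Iff.rfl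
  | bot => exact fun _ _ => Iff.rfl
  | imp φ ψ h1 h2 => exact fun v hv => by simp only [Sat, h1 v hv, h2 v hv]
  | all φ ih =>
    intro v hv
    constructor
    swap
    · exact fun h x hx => (ih _ (push_mem hx hv)).2 (h x trivial)
    -- An infinite assignment in `V_b` need not lie in one stage. Only finitely many values matter,
    -- so the assignment is made constant from `N` on; the next stage then contains a counterexample
    -- if there is one.
    obtain ⟨N, hN⟩ := exists_support.{u} φ.all
    obtain ⟨k, hk⟩ := hfin v hv N
    let w : ℕ → ZFSet.{u} := fun i => v (min i N)
    have hvw : ∀ i < N, v i = w i := fun i hi => by simp [w, min_eq_left hi.le]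
    have hw : ∀ i, w i ∈ vonNeumann (s k) := fun i => hk _ (min_le_right _ _)
    rw [hN P _ v w hvw, hN P Set.univ v w hvw]
    intro h
    by_contra hcon
    have : ∃ x, ¬ Sat P Set.univ (push x w) φ := by
      by_contra! h'
      exact hcon fun x _ => h' x
    obtain ⟨x, hx, hx'⟩ := exists_rank_lt_witness this
    have h1 : witness P φ w ≤ s (k + 1) := by
      rw [hs]
      refine le_trans ?_ (le_max_right _ _)
      exact le_ciSup (f := fun p : Fm × (ℕ → (vonNeumann (s k) : ZFSet.{u})) =>
        witness P p.1 fun i => (p.2 i).1) Ordinal.bddAbove_of_small (φ, fun i => ⟨w i, hw i⟩)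
    have hxb : x ∈ vonNeumann b := ZFSet.mem_vonNeumann.2 ((hx.trans_le h1).trans (hsb _))
    have hwb : ∀ i, w i ∈ vonNeumann b := fun i => hv _
    exact hx' ((ih _ (push_mem hxb hwb)).1 (h x hxb))

theorem exists_correct (P : Class.{u}) (a : Ordinal.{u}) :
    ∃ c : Cardinal.{u}, a < c.ord ∧ ∀ n, c.ord ∈ Correct P n := by
  obtain ⟨c, h1, h2⟩ := exists_reflecting P a
  exact ⟨c, h1, fun n => correct_of_sat_iff (bot_le.trans_lt h1) fun φ _ => h2 φ⟩

end PredSet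

namespace PredSet

open ZFSet (vonNeumann pair)

/-! ### Satisfaction relations as sets -/

/-- `w` is the assignment obtained from the assignment `v` in `M` by pushing `a`. Assignments are
coded by sets of pairs `(l, x)`; the parameters `K 0`, `K 1`, `K 2` stand for `ω`, the successor
relation on `ω`, and `0`. -/
def IsPush (K : ℕ → ZFSet.{u}) (M a v w : ZFSet.{u}) : Prop :=
  pair (K 2) a ∈ w ∧ ∀ l ∈ K 0, ∀ m ∈ K 0, pair l m ∈ K 1 → ∀ b ∈ M, pair l b ∈ v → pair m b ∈ w

/-- `F` is a set of assignments in `M` closed under pushing. -/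
def IsAssign (K : ℕ → ZFSet.{u}) (M F : ZFSet.{u}) : Prop :=
  (∀ v ∈ F, ∀ l ∈ K 0, ∃ a ∈ M, pair l a ∈ v) ∧
  (∀ v ∈ F, ∀ l ∈ K 0, ∀ a ∈ M, ∀ b ∈ M, pair l a ∈ v → pair l b ∈ v → a = b) ∧
  ∀ v ∈ F, ∀ a ∈ M, ∃ w ∈ F, IsPush K M a v w

/-- `T` satisfies Tarski's clauses for atomic formulas. -/
def TarskiAtom (P : Class.{u}) (K : ℕ → ZFSet.{u}) (M F T : ZFSet.{u}) : Prop :=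
  (∀ c ∈ K 0, ∀ i ∈ K 0, ∀ j ∈ K 0, pair c (pair i j) ∈ K 3 → ∀ v ∈ F,
    (pair c v ∈ T ↔ ∃ a ∈ M, pair i a ∈ v ∧ pair j a ∈ v)) ∧
  (∀ c ∈ K 0, ∀ i ∈ K 0, ∀ j ∈ K 0, pair c (pair i j) ∈ K 4 → ∀ v ∈ F,
    (pair c v ∈ T ↔ ∃ a ∈ M, ∃ b ∈ M, pair i a ∈ v ∧ pair j b ∈ v ∧ a ∈ b)) ∧
  (∀ c ∈ K 0, ∀ i ∈ K 0, pair c i ∈ K 5 → ∀ v ∈ F,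
    (pair c v ∈ T ↔ ∃ a ∈ M, pair i a ∈ v ∧ P a))

/-- `T` satisfies Tarski's clauses for compound formulas. -/
def TarskiComp (K : ℕ → ZFSet.{u}) (M F T : ZFSet.{u}) : Prop :=
  (∀ c ∈ K 6, ∀ v ∈ F, ¬ pair c v ∈ T) ∧
  (∀ c ∈ K 0, ∀ d ∈ K 0, ∀ e ∈ K 0, pair c (pair d e) ∈ K 7 → ∀ v ∈ F,
    (pair c v ∈ T ↔ (pair d v ∈ T → pair e v ∈ T))) ∧
  (∀ c ∈ K 0, ∀ d ∈ K 0, pair c d ∈ K 8 → ∀ v ∈ F,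
    (pair c v ∈ T ↔ ∀ a ∈ M, ∀ w ∈ F, IsPush K M a v w → pair d w ∈ T))

/-- `T` is a satisfaction relation for `⟨M, ∈, P ∩ M⟩` and the assignments in `F`. -/
def SatT (P : Class.{u}) (K : ℕ → ZFSet.{u}) (M F T : ZFSet.{u}) : Prop :=
  IsAssign K M F ∧ TarskiAtom P K M F T ∧ TarskiComp K M F T

/-- The assignment `w` is the image of the assignment `v` under the relation `i`. -/
def IsComp (K : ℕ → ZFSet.{u}) (y t i v w : ZFSet.{u}) : Prop :=
  ∀ l ∈ K 0, ∀ a ∈ y, ∀ b ∈ t, pair l a ∈ v → pair l b ∈ w → pair a b ∈ i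

/-- `i` is a function from `y` to `t` preserving the truth of the formulas with code in `S`. -/
def ElemT (P : Class.{u}) (K : ℕ → ZFSet.{u}) (S y t i F T F' T' : ZFSet.{u}) : Prop :=
  SatT P K y F T ∧ SatT P K t F' T' ∧ (∀ a ∈ y, ∃ b ∈ t, pair a b ∈ i) ∧
  (∀ a ∈ y, ∀ b ∈ t, ∀ b' ∈ t, pair a b ∈ i → pair a b' ∈ i → b = b') ∧
  (∃ v ∈ F, ∃ w ∈ F', IsComp K y t i v w) ∧
  ∀ v ∈ F, ∀ w ∈ F', IsComp K y t i v w → ∀ c ∈ S, (pair c v ∈ T ↔ pair c w ∈ T')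

namespace Del

variable {P : Class.{u}} (p : ℕ → ℕ)

theorem isPush (m a v w : ℕ) :
    Del P (fun e => IsPush (fun i => e (p i)) (e m) (e a) (e v) (e w)) := by
  unfold IsPush
  repeat' first | with_reducible exact pairMem _ _ _ | with_reducible apply Del.and | with_reducible apply Del.ball | with_reducible apply Del.imp

theorem isAssign (m f : ℕ) : Del P (fun e => IsAssign (fun i => e (p i)) (e m) (e f)) := by
  unfold IsAssign
  repeat' first
    | with_reducible exact pairMem _ _ _ | with_reducible exact Del.eq _ _ | with_reducible exact isPush _ _ _ _ _
    | with_reducible apply Del.and | with_reducible apply Del.ball | with_reducible apply Del.bex | with_reducible apply Del.imp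

theorem tarskiAtom (m f t : ℕ) :
    Del P (fun e => TarskiAtom P (fun i => e (p i)) (e m) (e f) (e t)) := by
  unfold TarskiAtom
  repeat' first
    | with_reducible exact pairMem _ _ _ | with_reducible exact tripleMem _ _ _ _ | with_reducible exact Del.mem _ _ | with_reducible exact Del.pred _
    | with_reducible apply Del.and | with_reducible apply Del.ball | with_reducible apply Del.bex | with_reducible apply Del.iff | with_reducible apply Del.imp

theorem tarskiComp (m f t : ℕ) :
    Del P (fun e => TarskiComp (fun i => e (p i)) (e m) (e f) (e t)) := by
  unfold TarskiComp
  repeat' first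
    | with_reducible exact pairMem _ _ _ | with_reducible exact tripleMem _ _ _ _ | with_reducible exact isPush _ _ _ _ _
    | with_reducible apply Del.and | with_reducible apply Del.ball | with_reducible apply Del.iff | with_reducible apply Del.not | with_reducible apply Del.imp

theorem satT (m f t : ℕ) : Del P (fun e => SatT P (fun i => e (p i)) (e m) (e f) (e t)) :=
  (isAssign p m f).and ((tarskiAtom p m f t).and (tarskiComp p m f t))

theorem isComp (y t i v w : ℕ) :
    Del P (fun e => IsComp (fun i => e (p i)) (e y) (e t) (e i) (e v) (e w)) := by
  unfold IsComp
  repeat' first | with_reducible exact pairMem _ _ _ | with_reducible apply Del.ball | with_reducible apply Del.imp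

theorem elemT (s y t i f g f' g' : ℕ) :
    Del P (fun e => ElemT P (fun i => e (p i)) (e s) (e y) (e t) (e i) (e f) (e g) (e f')
      (e g')) := by
  unfold ElemT
  repeat' first
    | with_reducible exact pairMem _ _ _ | with_reducible exact satT _ _ _ _ | with_reducible exact isComp _ _ _ _ _ _ | with_reducible exact Del.eq _ _
    | with_reducible apply Del.and | with_reducible apply Del.ball | with_reducible apply Del.bex | with_reducible apply Del.iff | with_reducible apply Del.imp

end Del

/-- The von Neumann natural number `n`. -/
noncomputable def num (n : ℕ) : ZFSet.{u} := (n : Ordinal.{u}).toZFSet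

theorem num_inj {m n : ℕ} : num.{u} m = num n ↔ m = n := by
  simp [num, Ordinal.toZFSet_injective.eq_iff]

/-- The intended values of the parameters. -/
noncomputable def stdK : ℕ → ZFSet.{u}
  | 0 => ZFSet.range num
  | 1 => ZFSet.range fun n : ℕ => pair (num n) (num (n + 1))
  | 2 => num 0
  | 3 => ZFSet.range fun q : ℕ × ℕ => pair (num (Fm.eq q.1 q.2).code) (pair (num q.1) (num q.2))
  | 4 => ZFSet.range fun q : ℕ × ℕ => pair (num (Fm.mem q.1 q.2).code) (pair (num q.1) (num q.2))
  | 5 => ZFSet.range fun i : ℕ => pair (num (Fm.pred i).code) (num i)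
  | 6 => ZFSet.range fun _ : Unit => num Fm.bot.code
  | 7 => ZFSet.range fun q : Fm × Fm =>
      pair (num (Fm.imp q.1 q.2).code) (pair (num q.1.code) (num q.2.code))
  | 8 => ZFSet.range fun φ : Fm => pair (num φ.all.code) (num φ.code)
  | 9 => ZFSet.range fun φ : Fm => num φ.code
  | n + 10 => ZFSet.range fun φ : {φ : Fm // FSigma n φ} => num φ.1.code

/-- The set `w` codes the assignment `v`, which takes values in `M`. -/
def Enc (M : ZFSet.{u}) (v : ℕ → ZFSet.{u}) (w : ZFSet.{u}) : Prop :=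
  ∀ l, v l ∈ M ∧ pair (num l) (v l) ∈ w

theorem mem_stdK_zero {x : ZFSet.{u}} : x ∈ stdK 0 ↔ ∃ n, num n = x := by simp [stdK]

@[simp] theorem num_mem (n : ℕ) : num.{u} n ∈ stdK 0 := mem_stdK_zero.2 ⟨n, rfl⟩

theorem num_succ_mem (n : ℕ) : pair (num.{u} n) (num (n + 1)) ∈ stdK 1 :=
  ZFSet.mem_range.2 ⟨n, rfl⟩

section
variable {P : Class.{u}} {M F T : ZFSet.{u}}

theorem IsAssign.eq_of_enc (h : IsAssign stdK M F) {w : ZFSet.{u}} (hw : w ∈ F)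
    {v : ℕ → ZFSet.{u}} (hv : Enc M v w) {l : ℕ} {a : ZFSet.{u}} (ha : a ∈ M) :
    pair (num l) a ∈ w ↔ a = v l :=
  ⟨fun H => h.2.1 w hw _ (num_mem l) a ha _ (hv l).1 H (hv l).2, fun H => H ▸ (hv l).2⟩

theorem IsAssign.exists_enc (h : IsAssign stdK M F) {w : ZFSet.{u}} (hw : w ∈ F) :
    ∃ v, Enc M v w := by
  choose v hv using fun l => h.1 w hw _ (num_mem l)
  exact ⟨v, hv⟩

theorem Enc.push {v : ℕ → ZFSet.{u}} {w w' a : ZFSet.{u}} (hv : Enc M v w) (ha : a ∈ M)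
    (h : IsPush stdK M a w w') : Enc M (push a v) w'
  | 0 => ⟨ha, h.1⟩
  | l + 1 => ⟨(hv l).1, h.2 _ (num_mem l) _ (num_mem _) (num_succ_mem l) _ (hv l).1 (hv l).2⟩

/-- A satisfaction relation computes the truth of formulas correctly. -/
theorem SatT.mem_iff (h : SatT P stdK M F T) (φ : Fm) : ∀ {v : ℕ → ZFSet.{u}} {w : ZFSet.{u}},
    w ∈ F → Enc M v w → (pair (num φ.code) w ∈ T ↔ Sat P (M : Set ZFSet.{u}) v φ) := by
  obtain ⟨hA, ⟨h3, h4, h5⟩, h6, h7, h8⟩ := h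
  induction φ with
  | eq i j =>
    intro v w hw hv
    rw [h3 _ (num_mem _) _ (num_mem i) _ (num_mem j) (ZFSet.mem_range.2 ⟨(i, j), rfl⟩) w hw]
    constructor
    · rintro ⟨a, ha, h1, h2⟩
      rw [hA.eq_of_enc hw hv ha] at h1 h2
      exact h1.symm.trans h2
    · intro H
      refine ⟨v i, (hv i).1, (hv i).2, ?_⟩
      rw [show v i = v j from H]
      exact (hv j).2
  | mem i j =>
    intro v w hw hv
    rw [h4 _ (num_mem _) _ (num_mem i) _ (num_mem j) (ZFSet.mem_range.2 ⟨(i, j), rfl⟩) w hw]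
    constructor
    · rintro ⟨a, ha, b, hb, h1, h2, h3⟩
      rw [hA.eq_of_enc hw hv ha] at h1
      rw [hA.eq_of_enc hw hv hb] at h2
      rwa [h1, h2] at h3
    · exact fun H => ⟨v i, (hv i).1, v j, (hv j).1, (hv i).2, (hv j).2, H⟩
  | pred i =>
    intro v w hw hv
    rw [h5 _ (num_mem _) _ (num_mem i) (ZFSet.mem_range.2 ⟨i, rfl⟩) w hw]
    constructor
    · rintro ⟨a, ha, h1, h2⟩
      rw [hA.eq_of_enc hw hv ha] at h1
      rwa [h1] at h2
    · exact fun H => ⟨v i, (hv i).1, (hv i).2, H⟩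
  | bot =>
    intro v w hw hv
    exact iff_of_false (h6 _ (by simp [stdK]) w hw) id
  | imp φ ψ ih1 ih2 =>
    intro v w hw hv
    rw [h7 _ (num_mem _) _ (num_mem φ.code) _ (num_mem ψ.code)
      (ZFSet.mem_range.2 ⟨(φ, ψ), rfl⟩) w hw, ih1 hw hv, ih2 hw hv]
    rfl
  | all φ ih =>
    intro v w hw hv
    rw [h8 _ (num_mem _) _ (num_mem φ.code) (ZFSet.mem_range.2 ⟨φ, rfl⟩) w hw]
    constructor
    · intro H a ha
      obtain ⟨w', hw', h'⟩ := hA.2.2 w hw a ha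
      exact (ih hw' (hv.push ha h')).1 (H a ha w' hw' h')
    · intro H a ha w' hw' h'
      exact (ih hw' (hv.push ha h')).2 (H a ha)

end

/-- The canonical code of an assignment. -/
noncomputable def enc (v : ℕ → ZFSet.{u}) : ZFSet.{u} := ZFSet.range fun l => pair (num l) (v l)

theorem pair_mem_enc {v : ℕ → ZFSet.{u}} {l : ℕ} {a : ZFSet.{u}} :
    pair (num l) a ∈ enc v ↔ a = v l := by
  simp only [enc, ZFSet.mem_range, ZFSet.pair_inj, num_inj]
  exact ⟨fun ⟨i, h1, h2⟩ => by rw [← h2, h1], fun h => ⟨l, rfl, h.symm⟩⟩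

/-- The set of all canonical codes of assignments in `M`. -/
noncomputable def fullF (M : ZFSet.{u}) : ZFSet.{u} :=
  ZFSet.sep (fun w => ∃ v : ℕ → ZFSet.{u}, (∀ i, v i ∈ M) ∧ w = enc v)
    (ZFSet.powerset (ZFSet.prod (stdK 0) M))

theorem mem_fullF {M w : ZFSet.{u}} :
    w ∈ fullF M ↔ ∃ v : ℕ → ZFSet.{u}, (∀ i, v i ∈ M) ∧ w = enc v := by
  simp only [fullF, ZFSet.mem_sep, ZFSet.mem_powerset, and_iff_right_iff_imp]
  rintro ⟨v, hv, rfl⟩ x hx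
  obtain ⟨l, rfl⟩ := ZFSet.mem_range.1 hx
  simp [hv]

/-- The satisfaction relation of `⟨M, ∈, P ∩ M⟩`. -/
noncomputable def fullT (P : Class.{u}) (M : ZFSet.{u}) : ZFSet.{u} :=
  ZFSet.sep (fun x => ∃ (φ : Fm) (v : ℕ → ZFSet.{u}), x = pair (num φ.code) (enc v) ∧
    Sat P (M : Set ZFSet.{u}) v φ) (ZFSet.prod (stdK 0) (fullF M))

theorem enc_injective : Function.Injective enc.{u} := by
  intro v w h
  funext l
  have : pair (num l) (v l) ∈ enc w := h ▸ pair_mem_enc.2 rfl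
  exact pair_mem_enc.1 this

theorem mem_fullT {P : Class.{u}} {M : ZFSet.{u}} {φ : Fm} {v : ℕ → ZFSet.{u}}
    (hv : ∀ i, v i ∈ M) :
    pair (num φ.code) (enc v) ∈ fullT P M ↔ Sat P (M : Set ZFSet.{u}) v φ := by
  simp only [fullT, ZFSet.mem_sep, ZFSet.pair_mem_prod, num_mem, true_and, ZFSet.pair_inj, num_inj]
  constructor
  · rintro ⟨_, ψ, w, ⟨h1, h2⟩, h⟩
    rwa [Fm.code_injective h1, enc_injective h2]
  · exact fun h => ⟨mem_fullF.2 ⟨v, hv, rfl⟩, φ, v, ⟨rfl, rfl⟩, h⟩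

theorem isPush_enc_iff {M a : ZFSet.{u}} {v w : ℕ → ZFSet.{u}} (hv : ∀ i, v i ∈ M) :
    IsPush stdK M a (enc v) (enc w) ↔ w = push a v := by
  constructor
  · rintro ⟨h1, h2⟩
    funext l
    cases l with
    | zero => exact (pair_mem_enc.1 h1).symm
    | succ l =>
      exact (pair_mem_enc.1 (h2 _ (num_mem l) _ (num_mem (l + 1)) (num_succ_mem l) _ (hv l)
        (pair_mem_enc.2 rfl))).symm
  · rintro rfl
    refine ⟨pair_mem_enc.2 rfl, fun l _ m _ hlm b _ hb => ?_⟩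
    obtain ⟨n, hn⟩ := ZFSet.mem_range.1 hlm
    obtain ⟨rfl, rfl⟩ := ZFSet.pair_inj.1 hn
    rw [pair_mem_enc] at hb ⊢
    exact hb

/-- Existence of satisfaction relations; `SatT.mem_iff` shows that any of them decides truth
correctly for the assignments in `F`. Hence quantifying over them existentially or universally
expresses the same thing. -/
theorem satT_full (P : Class.{u}) (M : ZFSet.{u}) : SatT P stdK M (fullF M) (fullT P M) := by
  refine ⟨⟨?_, ?_, ?_⟩, ⟨?_, ?_, ?_⟩, ?_, ?_, ?_⟩
  · intro w hw l hl
    obtain ⟨v, hv, rfl⟩ := mem_fullF.1 hw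
    obtain ⟨l, rfl⟩ := mem_stdK_zero.1 hl
    exact ⟨v l, hv l, pair_mem_enc.2 rfl⟩
  · intro w hw l hl a _ b _ h1 h2
    obtain ⟨v, hv, rfl⟩ := mem_fullF.1 hw
    obtain ⟨l, rfl⟩ := mem_stdK_zero.1 hl
    rw [pair_mem_enc.1 h1, pair_mem_enc.1 h2]
  · intro w hw a ha
    obtain ⟨v, hv, rfl⟩ := mem_fullF.1 hw
    exact ⟨enc (push a v), mem_fullF.2 ⟨_, push_mem ha hv, rfl⟩, (isPush_enc_iff hv).2 rfl⟩
  · intro c _ i _ j _ h w hw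
    obtain ⟨v, hv, rfl⟩ := mem_fullF.1 hw
    obtain ⟨q, hq⟩ := ZFSet.mem_range.1 h
    obtain ⟨rfl, rfl, rfl⟩ : _ ∧ _ ∧ _ := by simpa only [ZFSet.pair_inj] using hq
    rw [mem_fullT hv]
    simp only [pair_mem_enc]
    exact ⟨fun H => ⟨v q.1, hv _, rfl, H⟩, fun ⟨a, _, h1, h2⟩ => h1.symm.trans h2⟩
  · intro c _ i _ j _ h w hw
    obtain ⟨v, hv, rfl⟩ := mem_fullF.1 hw
    obtain ⟨q, hq⟩ := ZFSet.mem_range.1 h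
    obtain ⟨rfl, rfl, rfl⟩ : _ ∧ _ ∧ _ := by simpa only [ZFSet.pair_inj] using hq
    rw [mem_fullT hv]
    simp only [pair_mem_enc]
    exact ⟨fun H => ⟨v q.1, hv _, v q.2, hv _, rfl, rfl, H⟩,
      fun ⟨a, _, b, _, h1, h2, h3⟩ => by rw [h1, h2] at h3; exact h3⟩
  · intro c _ i _ h w hw
    obtain ⟨v, hv, rfl⟩ := mem_fullF.1 hw
    obtain ⟨q, hq⟩ := ZFSet.mem_range.1 h
    obtain ⟨rfl, rfl⟩ : _ ∧ _ := by simpa only [ZFSet.pair_inj] using hq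
    rw [mem_fullT hv]
    simp only [pair_mem_enc]
    exact ⟨fun H => ⟨v q, hv _, rfl, H⟩, fun ⟨a, _, h1, h2⟩ => by rw [h1] at h2; exact h2⟩
  · intro c h w hw
    obtain ⟨v, hv, rfl⟩ := mem_fullF.1 hw
    obtain ⟨_, rfl⟩ := ZFSet.mem_range.1 h
    rw [mem_fullT hv]
    exact id
  · intro c _ d _ e _ h w hw
    obtain ⟨v, hv, rfl⟩ := mem_fullF.1 hw
    obtain ⟨q, hq⟩ := ZFSet.mem_range.1 h
    obtain ⟨rfl, rfl, rfl⟩ : _ ∧ _ ∧ _ := by simpa only [ZFSet.pair_inj] using hq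
    rw [mem_fullT hv, mem_fullT hv, mem_fullT hv]
    rfl
  · intro c _ d _ h w hw
    obtain ⟨v, hv, rfl⟩ := mem_fullF.1 hw
    obtain ⟨q, hq⟩ := ZFSet.mem_range.1 h
    obtain ⟨rfl, rfl⟩ : _ ∧ _ := by simpa only [ZFSet.pair_inj] using hq
    rw [mem_fullT hv]
    constructor
    · intro H a ha w' hw' hp
      obtain ⟨v', hv', rfl⟩ := mem_fullF.1 hw'
      rw [isPush_enc_iff hv] at hp
      subst hp
      exact (mem_fullT hv').2 (H a ha)
    · intro H a ha
      exact (mem_fullT (push_mem ha hv)).1 (H a ha _ (mem_fullF.2 ⟨_, push_mem ha hv, rfl⟩)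
        ((isPush_enc_iff hv).2 rfl))

/-- The function coded by `i` preserves the truth of the formulas with code in `S`. -/
theorem ElemT.sound {P : Class.{u}} {S y t i F T F' T' : ZFSet.{u}}
    (h : ElemT P stdK S y t i F T F' T') : ∃ f : ZFSet.{u} → ZFSet.{u},
      (∀ a ∈ y, f a ∈ t) ∧ (∀ a ∈ y, ∀ b ∈ t, pair a b ∈ i → f a = b) ∧
      ∀ φ : Fm, num φ.code ∈ S → ∀ v : ℕ → ZFSet.{u}, (∀ k, v k ∈ y) →
        (Sat P (y : Set ZFSet.{u}) v φ ↔ Sat P (t : Set ZFSet.{u}) (fun k => f (v k)) φ) := by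
  obtain ⟨hy, ht, h1, h2, ⟨v0, hv0, w0, hw0, h0⟩, h3⟩ := h
  have : ∀ a, ∃ b, a ∈ y → b ∈ t ∧ pair a b ∈ i := fun a => by
    by_cases ha : a ∈ y
    · obtain ⟨b, hb⟩ := h1 a ha
      exact ⟨b, fun _ => hb⟩
    · exact ⟨∅, fun h => absurd h ha⟩
  choose f hf using this
  have hfi : ∀ a ∈ y, ∀ b ∈ t, pair a b ∈ i → f a = b := fun a ha b hb hab =>
    h2 a ha _ (hf a ha).1 b hb (hf a ha).2 hab
  refine ⟨f, fun a ha => (hf a ha).1, hfi, fun φ hφ v hv => ?_⟩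
  have hcomp : ∀ {v : ℕ → ZFSet.{u}} {w w' : ZFSet.{u}}, w ∈ F → w' ∈ F' → Enc y v w →
      Enc t (fun k => f (v k)) w' → IsComp stdK y t i w w' := by
    intro v w w' hw hw' he he' l hl a ha b hb h1 h2
    obtain ⟨l, rfl⟩ := mem_stdK_zero.1 hl
    rw [hy.1.eq_of_enc hw he ha] at h1
    rw [ht.1.eq_of_enc hw' he' hb] at h2
    rw [h2, ← h1]
    exact (hf a ha).2
  obtain ⟨N, hN⟩ := exists_support.{u} φ
  -- `F` and `F'` need not contain all assignments. From the comparable pair `v0`, `w0`, pushing `N`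
  -- values on both sides in parallel yields assignments with prescribed values below `N`, which is
  -- all that `φ` depends on.
  have key : ∀ (N : ℕ) (v : ℕ → ZFSet.{u}), (∀ k, v k ∈ y) → ∃ (v' : ℕ → ZFSet.{u}), ∃ w ∈ F,
      ∃ w' ∈ F', (∀ k < N, v k = v' k) ∧ Enc y v' w ∧ Enc t (fun k => f (v' k)) w' := by
    intro N
    induction N with
    | zero =>
      intro v hv
      obtain ⟨u, hu⟩ := hy.1.exists_enc hv0
      refine ⟨u, v0, hv0, w0, hw0, by simp, hu, fun l => ?_⟩
      obtain ⟨b, hb, hb'⟩ := ht.1.1 w0 hw0 _ (num_mem l)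
      have := hfi _ (hu l).1 b hb (h0 _ (num_mem l) _ (hu l).1 b hb (hu l).2 hb')
      exact ⟨by simpa only [this] using hb, by simpa only [this] using hb'⟩
    | succ N ih =>
      intro v hv
      obtain ⟨v', w, hw, w', hw', hk, he, he'⟩ := ih (fun k => v (k + 1)) (fun k => hv _)
      obtain ⟨x, hx, hpx⟩ := hy.1.2.2 w hw (v 0) (hv 0)
      obtain ⟨x', hx', hpx'⟩ := ht.1.2.2 w' hw' (f (v 0)) (hf _ (hv 0)).1
      refine ⟨push (v 0) v', x, hx, x', hx', fun k hk' => ?_, he.push (hv 0) hpx, ?_⟩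
      · cases k with
        | zero => rfl
        | succ k => exact hk k (by omega)
      · rw [comp_push]
        exact he'.push (hf _ (hv 0)).1 hpx'
  obtain ⟨v', w, hw, w', hw', hk, he, he'⟩ := key N v hv
  rw [hN P y v v' hk, hN P t (fun k => f (v k)) (fun k => f (v' k))
    (fun k hk' => by simp only [hk k hk']),
    ← hy.mem_iff φ hw he, ← ht.mem_iff φ hw' he']
  exact h3 w hw w' hw' (hcomp hw hw' he he') _ hφ

/-- The graph of `f` on `y`, as a set. -/
noncomputable def graph (f : ZFSet.{u} → ZFSet.{u}) (y t : ZFSet.{u}) : ZFSet.{u} :=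
  ZFSet.sep (fun p => ∃ a, p = pair a (f a)) (ZFSet.prod y t)

theorem pair_mem_graph {f : ZFSet.{u} → ZFSet.{u}} {y t a b : ZFSet.{u}} (ha : a ∈ y)
    (hb : b ∈ t) : pair a b ∈ graph f y t ↔ f a = b := by
  simp only [graph, ZFSet.mem_sep, ZFSet.pair_mem_prod, ha, hb, true_and, ZFSet.pair_inj]
  exact ⟨fun ⟨c, h1, h2⟩ => by rw [h1, h2], fun h => ⟨a, rfl, h.symm⟩⟩

theorem elemT_full {P : Class.{u}} {S y t : ZFSet.{u}} {f : ZFSet.{u} → ZFSet.{u}}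
    (hne : y.Nonempty) (hf : ∀ a ∈ y, f a ∈ t) (hS : ∀ c ∈ S, ∃ φ : Fm, num φ.code = c ∧
      ∀ v : ℕ → ZFSet.{u}, (∀ k, v k ∈ y) →
        (Sat P (y : Set ZFSet.{u}) v φ ↔ Sat P (t : Set ZFSet.{u}) (fun k => f (v k)) φ)) :
    ElemT P stdK S y t (graph f y t) (fullF y) (fullT P y) (fullF t) (fullT P t) := by
  refine ⟨satT_full P y, satT_full P t, fun a ha => ⟨f a, hf a ha, ?_⟩, ?_, ?_, ?_⟩
  · exact (pair_mem_graph ha (hf a ha)).2 rfl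
  · intro a ha b hb b' hb' h1 h2
    rw [pair_mem_graph ha ‹_›] at h1 h2
    exact h1.symm.trans h2
  · obtain ⟨a, ha⟩ := hne
    refine ⟨enc fun _ => a, mem_fullF.2 ⟨_, fun _ => ha, rfl⟩, enc fun _ => f a,
      mem_fullF.2 ⟨_, fun _ => hf a ha, rfl⟩, ?_⟩
    intro l hl b hb c hc h1 h2
    obtain ⟨l, rfl⟩ := mem_stdK_zero.1 hl
    rw [pair_mem_enc] at h1 h2
    rw [pair_mem_graph hb hc, h1, h2]
  · intro w hw w' hw' hc c hcS
    obtain ⟨φ, rfl, hφ⟩ := hS c hcS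
    obtain ⟨v, hv, rfl⟩ := mem_fullF.1 hw
    obtain ⟨v', hv', rfl⟩ := mem_fullF.1 hw'
    have : v' = fun k => f (v k) := by
      funext l
      exact ((pair_mem_graph (hv l) (hv' l)).1 (hc _ (num_mem l) _ (hv l) _ (hv' l)
        (pair_mem_enc.2 rfl) (pair_mem_enc.2 rfl))).symm
    subst this
    rw [mem_fullT hv, mem_fullT hv']
    exact hφ v hv

/-! ### `Σₙ`-correctness as a `Πₙ` property -/

/-- The internal definition of `Σₙ`-correctness of transitive sets. -/
def ITT (P : Class.{u}) : ℕ → (ℕ → ZFSet.{u}) → ZFSet.{u} → Prop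
  | 0, _, M => M.IsTransitive
  | n + 1, K, M => M.IsTransitive ∧ ∀ b F T F' T', (ITT P n K b ∧ M ⊆ b ∧ SatT P K M F T ∧
      SatT P K b F' T') → ∀ v ∈ F, v ∈ F' → ∀ c ∈ K (n + 11), (pair c v ∈ T ↔ pair c v ∈ T')

theorem piD_itt (P : Class.{u}) (n : ℕ) :
    ∀ (p : ℕ → ℕ) (m : ℕ), PiD P n (fun e => ITT P n (fun i => e (p i)) (e m)) := by
  induction n with
  | zero => exact fun p m => (Del.isTransitive m).piD
  | succ n ih =>
    intro p m
    refine (Del.isTransitive m).piD.and ?_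
    refine PiD.forall (PiD.forall (PiD.forall (PiD.forall (PiD.forall ?_))))
    -- `PiD` asks for the negated matrix to be `Σₙ₊₁`: a `Πₙ` premise together with `Δ₀` conditions.
    -- The shift by five makes room for `b`, `F`, `T`, `F'`, `T'`, which are the variables `4` to
    -- `0`.
    have h1 : SigD P (n + 1) (fun e => ITT P n (fun i => e (p i + 5)) (e 4) ∧ e (m + 5) ⊆ e 4 ∧
        SatT P (fun i => e (p i + 5)) (e (m + 5)) (e 3) (e 2) ∧
        SatT P (fun i => e (p i + 5)) (e 4) (e 1) (e 0)) :=
      (ih (fun i => p i + 5) 4).sigD.and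
        ((Del.subset _ _).and ((Del.satT _ _ _ _).and (Del.satT _ _ _ _))).sigD
    have h2 : Del P (fun e => ∀ v ∈ e 3, v ∈ e 1 → ∀ c ∈ e (p (n + 11) + 5),
        (pair c v ∈ e 2 ↔ pair c v ∈ e 0)) := by
      repeat' first
        | with_reducible exact Del.pairMem _ _ _ | with_reducible exact Del.mem _ _
        | with_reducible apply Del.ball | with_reducible apply Del.iff
        | with_reducible apply Del.imp
    exact (h1.and h2.not.sigD).congr fun e => (Classical.not_imp).symm

theorem exists_correct_superset (P : Class.{u}) (x : ZFSet.{u}) :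
    ∃ c : Cardinal.{u}, x ⊆ vonNeumann c.ord ∧ ∀ n, c.ord ∈ Correct P n := by
  obtain ⟨c, h1, h2⟩ := exists_correct P x.rank
  exact ⟨c, ZFSet.subset_vonNeumann.2 h1.le, h2⟩

theorem num_code_mem {n : ℕ} {φ : Fm} (h : FSigma n φ) : num.{u} φ.code ∈ stdK (n + 10) :=
  ZFSet.mem_range.2 ⟨⟨φ, h⟩, rfl⟩

theorem exists_of_mem_stdK {n : ℕ} {c : ZFSet.{u}} (h : c ∈ stdK (n + 10)) :
    ∃ φ : Fm, FSigma n φ ∧ num φ.code = c := by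
  obtain ⟨φ, rfl⟩ := ZFSet.mem_range.1 h
  exact ⟨φ.1, φ.2, rfl⟩

/-- Truth in the universe is replaced by truth in `Σₙ`-correct supersets `b` of `M`. If `M` is
correct, `TT.between` gives agreement with every such `b`; conversely, agreement with one fully
reflecting level is agreement with the universe. -/
theorem itt_iff (P : Class.{u}) (n : ℕ) :
    ∀ M : ZFSet.{u}, ITT P n stdK M ↔ TT P n (M : Set ZFSet.{u}) := by
  have htr : ∀ M : ZFSet.{u}, M.IsTransitive ↔ TransClass (M : Set ZFSet.{u}) := fun M =>
    ⟨fun h x hx y hy => h x hx hy, fun h x hx y hy => h x hx y hy⟩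
  induction n with
  | zero => exact fun M => (htr M).trans TT.zero_iff.symm
  | succ n ih =>
    intro M
    constructor
    · rintro ⟨h1, h2⟩
      refine ⟨(htr M).1 h1, fun φ hφ v hv => ?_⟩
      obtain ⟨c, hMc, hc⟩ := exists_correct_superset P M
      have hb := (ih (vonNeumann c.ord)).2 (Correct.tt (hc n))
      have := h2 _ _ _ _ _ ⟨hb, hMc, satT_full P M, satT_full P _⟩ (enc v)
        (mem_fullF.2 ⟨v, hv, rfl⟩) (mem_fullF.2 ⟨v, fun i => hMc (hv i), rfl⟩) _
        (num_code_mem hφ)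
      rw [mem_fullT hv, mem_fullT fun i => hMc (hv i)] at this
      exact this.trans (Correct.sat_iff (hc (n + 1)) hφ fun i => hMc (hv i))
    · intro h
      refine ⟨(htr M).2 h.1, ?_⟩
      rintro b F T F' T' ⟨hb, hMb, hT, hT'⟩ w hw hw' c hc
      obtain ⟨φ, hφ, rfl⟩ := exists_of_mem_stdK hc
      obtain ⟨v, hv⟩ := hT.1.exists_enc hw
      rw [hT.mem_iff φ hw hv, hT'.mem_iff φ hw' fun l => ⟨hMb (hv l).1, (hv l).2⟩]
      exact h.between ((ih b).1 hb) hMb hφ fun i => (hv i).1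

end PredSet

namespace PredSet

open ZFSet (vonNeumann pair)
open Order FirstOrder

/-! ### The von Neumann hierarchy and closure of limit levels -/

/-- The set `x` satisfies the recursion of the von Neumann hierarchy with respect to `h`. -/
def HierAt (h x : ZFSet.{u}) : Prop := ∀ r ∈ h, (x ∈ r ↔ ∃ s ∈ h, s ∈ r ∧ x ⊆ s)

/-- `h` is a set of levels of the von Neumann hierarchy, closed under smaller levels. -/
def IsHier (h : ZFSet.{u}) : Prop := ∀ x, HierAt h x

theorem Del.hierAt {P : Class.{u}} (h x : ℕ) : Del P (fun e => HierAt (e h) (e x)) := by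
  unfold HierAt
  repeat' first
    | with_reducible exact Del.mem _ _ | with_reducible exact Del.subset _ _
    | with_reducible apply Del.and | with_reducible apply Del.ball
    | with_reducible apply Del.bex | with_reducible apply Del.iff

/-- By `∈`-induction. If `rank x < rank r`, some `y ∈ r` has rank at least that of `x`; it is
included in some `s ∈ r` in `h`, which by induction is a level, so `x ⊆ s` as well. -/
theorem IsHier.eq_vonNeumann {h : ZFSet.{u}} (H : IsHier h) :
    ∀ r : ZFSet.{u}, r ∈ h → r = vonNeumann r.rank := by
  intro r
  induction r using ZFSet.inductionOn with
  | _ r ih =>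
    intro hr
    ext x
    constructor
    · exact fun hx => ZFSet.mem_vonNeumann.2 (ZFSet.rank_lt_of_mem hx)
    · intro hx
      obtain ⟨y, hy, hxy⟩ := ZFSet.lt_rank_iff.1 (ZFSet.mem_vonNeumann.1 hx)
      obtain ⟨s, hs, hsr, hys⟩ := (H y r hr).1 hy
      refine (H x r hr).2 ⟨s, hs, hsr, ?_⟩
      rw [ih s hsr hs]
      exact ZFSet.subset_vonNeumann.2 (hxy.trans (ZFSet.rank_mono hys))

/-- The set of all `V_b` with `b ≤ a`. -/
noncomputable def hierSet (a : Ordinal.{u}) : ZFSet.{u} :=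
  ZFSet.sep (fun x => ∃ b, x = vonNeumann b) (vonNeumann (succ a))

theorem mem_hierSet {a : Ordinal.{u}} {x : ZFSet.{u}} :
    x ∈ hierSet a ↔ ∃ b ≤ a, x = vonNeumann b := by
  rw [hierSet, ZFSet.mem_sep]
  constructor
  · rintro ⟨h, b, rfl⟩
    exact ⟨b, lt_succ_iff.1 (by simpa using h), rfl⟩
  · rintro ⟨b, hb, rfl⟩
    exact ⟨by simpa using hb, b, rfl⟩

theorem isHier_hierSet (a : Ordinal.{u}) : IsHier (hierSet a) := by
  intro x r hr
  obtain ⟨c, hc, rfl⟩ := mem_hierSet.1 hr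
  rw [ZFSet.mem_vonNeumann']
  constructor
  · rintro ⟨b, hb, hx⟩
    exact ⟨_, mem_hierSet.2 ⟨b, hb.le.trans hc, rfl⟩, by simpa using hb, hx⟩
  · rintro ⟨s, hs, hsr, hx⟩
    obtain ⟨b, hb, rfl⟩ := mem_hierSet.1 hs
    exact ⟨b, by simpa using hsr, hx⟩

/-- `V_t` contains all elements and all subsets of members of `h`, so a set outside `V_t` satisfies
neither side of the recursion. -/
theorem isHier_of_forall_mem {t : Ordinal.{u}} {h : ZFSet.{u}} (hh : h ∈ vonNeumann t)
    (H : ∀ x ∈ vonNeumann t, HierAt h x) : IsHier h := by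
  intro x r hr
  have hrt := ZFSet.isTransitive_vonNeumann t _ hh hr
  constructor
  · exact fun hx => (H x (ZFSet.isTransitive_vonNeumann t _ hrt hx) r hr).1 hx
  · rintro ⟨s, hs, hsr, hx⟩
    exact (H x (ZFSet.mem_vonNeumann_of_subset hx (ZFSet.isTransitive_vonNeumann t _ hh hs))
      r hr).2 ⟨s, hs, hsr, hx⟩

section
variable {b : Ordinal.{u}} {x y : ZFSet.{u}}

theorem isSuccLimit_of {b : Ordinal.{u}} (h0 : 0 < b) (h : ∀ a < b, succ a < b) : IsSuccLimit b :=
  ⟨by simpa using h0.ne', isSuccPrelimit_of_succ_lt h⟩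

theorem mem_vonNeumann_of_rank_le (hb : IsSuccLimit b) {a : Ordinal.{u}} (ha : a < b)
    (h : ZFSet.rank x ≤ succ a) : x ∈ vonNeumann b :=
  ZFSet.mem_vonNeumann.2 (h.trans_lt (hb.succ_lt ha))

theorem hierSet_mem (hb : IsSuccLimit b) {a : Ordinal.{u}} (ha : a < b) :
    hierSet a ∈ vonNeumann b :=
  mem_vonNeumann_of_rank_le hb ha (ZFSet.subset_vonNeumann.1 ZFSet.sep_subset)

theorem pair_mem (hb : IsSuccLimit b) (hx : x ∈ vonNeumann b) (hy : y ∈ vonNeumann b) :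
    pair x y ∈ vonNeumann b := by
  rw [ZFSet.mem_vonNeumann] at *
  simp only [ZFSet.pair, ZFSet.rank_pair, ZFSet.rank_singleton]
  refine max_lt (hb.succ_lt (hb.succ_lt hx)) (hb.succ_lt (max_lt (hb.succ_lt hx) (hb.succ_lt hy)))

theorem powerset_mem (hb : IsSuccLimit b) (hx : x ∈ vonNeumann b) :
    ZFSet.powerset x ∈ vonNeumann b := by
  rw [ZFSet.mem_vonNeumann] at *
  rw [ZFSet.rank_powerset]
  exact hb.succ_lt hx

theorem prod_mem (hb : IsSuccLimit b) (hx : x ∈ vonNeumann b) (hy : y ∈ vonNeumann b) :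
    ZFSet.prod x y ∈ vonNeumann b := by
  refine ZFSet.mem_vonNeumann_of_subset
    (y := ZFSet.powerset (ZFSet.powerset (x ∪ y)))
    (by unfold ZFSet.prod ZFSet.pairSep; exact ZFSet.sep_subset)
    (powerset_mem hb (powerset_mem hb ?_))
  rw [ZFSet.mem_vonNeumann] at *
  rw [ZFSet.rank_union]
  exact max_lt hx hy

theorem num_mem_omega (n : ℕ) : num.{u} n ∈ vonNeumann Ordinal.omega0 := by
  rw [ZFSet.mem_vonNeumann, num, Ordinal.rank_toZFSet]
  exact Ordinal.natCast_lt_omega0 n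

theorem stdK_subset (i : ℕ) : stdK.{u} i ⊆ vonNeumann Ordinal.omega0 := by
  have hl : IsSuccLimit (Ordinal.omega0.{u}) := Ordinal.isSuccLimit_omega0
  intro x hx
  match i with
  | 0 | 6 | 9 | _ + 10 =>
    obtain ⟨q, rfl⟩ := ZFSet.mem_range.1 hx
    exact num_mem_omega _
  | 1 | 5 | 8 =>
    obtain ⟨q, rfl⟩ := ZFSet.mem_range.1 hx
    exact pair_mem hl (num_mem_omega _) (num_mem_omega _)
  | 2 => exact ZFSet.isTransitive_vonNeumann _ _ (num_mem_omega 0) hx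
  | 3 | 4 | 7 =>
    obtain ⟨q, rfl⟩ := ZFSet.mem_range.1 hx
    exact pair_mem hl (num_mem_omega _) (pair_mem hl (num_mem_omega _) (num_mem_omega _))

/-- Thus the parameters are fixed by every embedding whose critical point is above `ω`. -/
theorem stdK_mem (hb : Ordinal.omega0 < b) (i : ℕ) : stdK i ∈ vonNeumann b :=
  ZFSet.mem_vonNeumann.2 ((ZFSet.subset_vonNeumann.1 (stdK_subset i)).trans_lt hb)

theorem fullF_mem (hb : IsSuccLimit b) (hω : Ordinal.omega0 < b) (hx : x ∈ vonNeumann b) :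
    fullF x ∈ vonNeumann b :=
  ZFSet.mem_vonNeumann_of_subset ZFSet.sep_subset
    (powerset_mem hb (prod_mem hb (stdK_mem hω 0) hx))

theorem fullT_mem (P : Class.{u}) (hb : IsSuccLimit b) (hω : Ordinal.omega0 < b)
    (hx : x ∈ vonNeumann b) : fullT P x ∈ vonNeumann b :=
  ZFSet.mem_vonNeumann_of_subset ZFSet.sep_subset
    (prod_mem hb (stdK_mem hω 0) (fullF_mem hb hω hx))

theorem graph_mem (f : ZFSet.{u} → ZFSet.{u}) (hb : IsSuccLimit b) (hx : x ∈ vonNeumann b)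
    (hy : y ∈ vonNeumann b) : graph f x y ∈ vonNeumann b :=
  ZFSet.mem_vonNeumann_of_subset ZFSet.sep_subset (prod_mem hb hx hy)

end

theorem Correct.isSuccLimit {P : Class.{u}} {n : ℕ} (hn : 1 ≤ n) {a : Ordinal.{u}}
    (ha : a ∈ Correct P n) : IsSuccLimit a := by
  refine isSuccLimit_of (Correct.pos hn ha) fun b hb => ?_
  have hV : vonNeumann b ∈ vonNeumann a := by simpa using hb
  -- "Some set has `x` as an element", applied to `x = V_b`, forces a set of rank above `b` into
  -- `V_a`.
  have hσ : FSigma 1 (Fm.mem 1 0).ex := .ex (.delta (.mem _ _))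
  have h := (Correct.sat_iff ha (hσ.mono hn) (v := fun _ => vonNeumann b) fun _ => hV).2 (by
    rw [sat_ex]
    exact ⟨{vonNeumann b}, trivial, ZFSet.mem_singleton.2 rfl⟩)
  rw [sat_ex] at h
  obtain ⟨y, hy, hby⟩ := h
  have h1 : b < y.rank := by simpa using ZFSet.rank_lt_of_mem (show vonNeumann b ∈ y from hby)
  exact (succ_le_of_lt h1).trans_lt (ZFSet.mem_vonNeumann.1 hy)

/-! ### Elementary embeddings between levels -/

/-- `f` restricts to an elementary embedding of `⟨V_l, ∈, P ∩ V_l⟩` in `⟨V_t, ∈, P ∩ V_t⟩`. -/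
structure Emb (P : Class.{u}) (l t : Ordinal.{u}) (f : ZFSet.{u} → ZFSet.{u}) : Prop where
  maps : ∀ x ∈ vonNeumann l, f x ∈ vonNeumann t
  sat : ∀ (φ : Fm) (v : ℕ → ZFSet.{u}), (∀ i, v i ∈ vonNeumann l) →
    (Sat P (vonNeumann l : Set ZFSet.{u}) v φ ↔
      Sat P (vonNeumann t : Set ZFSet.{u}) (fun i => f (v i)) φ)

namespace Emb

variable {P : Class.{u}} {l t : Ordinal.{u}} {f : ZFSet.{u} → ZFSet.{u}}

theorem del (E : Emb P l t f) {R : (ℕ → ZFSet.{u}) → Prop} (hR : Del P R) {v : ℕ → ZFSet.{u}}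
    (hv : ∀ i, v i ∈ vonNeumann l) : R v ↔ R (fun i => f (v i)) := by
  obtain ⟨φ, _, h⟩ := hR
  rw [← h _ (transClass_vonNeumann l) v hv, ← h _ (transClass_vonNeumann t) _
    fun i => E.maps _ (hv i)]
  exact E.sat φ v hv

theorem del_all (E : Emb P l t f) {R : (ℕ → ZFSet.{u}) → Prop} (hR : Del P R) {v : ℕ → ZFSet.{u}}
    (hv : ∀ i, v i ∈ vonNeumann l) : (∀ x ∈ vonNeumann l, R (push x v)) ↔
      ∀ x ∈ vonNeumann t, R (push x fun i => f (v i)) := by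
  obtain ⟨φ, _, h⟩ := hR
  refine Iff.trans ?_ ((E.sat φ.all v hv).trans ?_)
  · exact forall₂_congr fun x hx => (h _ (transClass_vonNeumann l) _ (push_mem hx hv)).symm
  · exact forall₂_congr fun x hx => h _ (transClass_vonNeumann t) _
      (push_mem hx fun i => E.maps _ (hv i))

theorem mem_iff (E : Emb P l t f) {x y : ZFSet.{u}} (hx : x ∈ vonNeumann l)
    (hy : y ∈ vonNeumann l) : x ∈ y ↔ f x ∈ f y :=
  E.del (Del.mem 0 1) (v := push x fun _ => y) (push_mem hx fun _ => hy)

theorem subset (E : Emb P l t f) {x y : ZFSet.{u}} (hx : x ∈ vonNeumann l)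
    (hy : y ∈ vonNeumann l) : x ⊆ y ↔ f x ⊆ f y :=
  E.del (Del.subset 0 1) (v := push x fun _ => y) (push_mem hx fun _ => hy)

theorem isSuccLimit (E : Emb P l t f) (hl : IsSuccLimit l) : IsSuccLimit t := by
  have h0 : (∅ : ZFSet.{u}) ∈ vonNeumann l := by
    rw [ZFSet.mem_vonNeumann, ZFSet.rank_empty]; exact hl.bot_lt
  have h := (E.sat (Fm.mem 1 0).ex.all (fun _ => ∅) fun _ => h0).1 fun x hx => by
    rw [sat_ex]
    refine ⟨{x}, ?_, ZFSet.mem_singleton.2 rfl⟩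
    rw [SetLike.mem_coe, ZFSet.mem_vonNeumann, ZFSet.rank_singleton]
    exact hl.succ_lt (ZFSet.mem_vonNeumann.1 hx)
  refine isSuccLimit_of (bot_le.trans_lt (ZFSet.mem_vonNeumann.1 (E.maps _ h0))) fun b hb => ?_
  have hV : vonNeumann b ∈ vonNeumann t := by simpa using hb
  have h := h (vonNeumann b) hV
  rw [sat_ex] at h
  obtain ⟨y, hy, hby⟩ := h
  have h1 : b < y.rank := by simpa using ZFSet.rank_lt_of_mem (show vonNeumann b ∈ y from hby)
  exact (succ_le_of_lt h1).trans_lt (ZFSet.mem_vonNeumann.1 hy)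

theorem isHier (E : Emb P l t f) {h : ZFSet.{u}} (hh : h ∈ vonNeumann l) (H : IsHier h) :
    IsHier (f h) :=
  isHier_of_forall_mem (E.maps _ hh)
    ((E.del_all (Del.hierAt 1 0) (v := fun _ => h) fun _ => hh).1 fun x _ => H x)

theorem toZFSet_mem {a l : Ordinal.{u}} (h : a < l) : a.toZFSet ∈ vonNeumann l := by
  simpa [ZFSet.mem_vonNeumann] using h

theorem toZFSet_succ_eq (a : Ordinal.{u}) :
    (succ a).toZFSet = insert a.toZFSet a.toZFSet := by
  rw [succ_eq_add_one, Ordinal.toZFSet_add_one]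

/-- Elementary embeddings map levels to levels. -/
theorem exists_level (E : Emb P l t f) (hl : IsSuccLimit l) {a : Ordinal.{u}} (ha : a < l) :
    ∃ b < t, f (vonNeumann a) = vonNeumann b ∧ f a.toZFSet = b.toZFSet := by
  have hV : vonNeumann a ∈ vonNeumann l := by simpa using ha
  have hh := hierSet_mem hl ha
  have h1 := (E.mem_iff hV hh).1 (mem_hierSet.2 ⟨a, le_rfl, rfl⟩)
  have h2 := (E.isHier hh (isHier_hierSet a)).eq_vonNeumann _ h1
  set b := (f (vonNeumann a)).rank
  refine ⟨b, ZFSet.mem_vonNeumann.1 (E.maps _ hV), h2, ?_⟩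
  -- This identifies `a` as the set of ordinals in `V_a`, so its image is the set of ordinals in
  -- `V_b`.
  have hR : Del P (fun e => ∀ x ∈ e 0, x ∈ e 1 ↔ x.IsOrdinal) :=
    .ball 0 ((Del.mem _ _).iff (Del.isOrdinal _))
  have h3 := (E.del hR (v := push (vonNeumann a) fun _ => a.toZFSet)
    (push_mem hV fun _ => toZFSet_mem ha)).1 (by
      intro x hx
      simp only [push_zero] at hx
      change x ∈ a.toZFSet ↔ _
      constructor
      · intro h
        obtain ⟨c, _, rfl⟩ := Ordinal.mem_toZFSet_iff.1 h
        exact ZFSet.isOrdinal_toZFSet c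
      · intro h
        rw [← h.toZFSet_rank_eq, Ordinal.toZFSet_mem_toZFSet_iff]
        exact ZFSet.mem_vonNeumann.1 hx)
  have h4 := (E.subset (toZFSet_mem ha) hV).1 (Ordinal.toZFSet_subset_vonNeumann a)
  change ∀ x ∈ f (vonNeumann a), x ∈ f a.toZFSet ↔ _ at h3
  rw [h2] at h3 h4
  ext x
  constructor
  · intro hx
    have := (h3 x (h4 hx)).1 hx
    rw [← this.toZFSet_rank_eq, Ordinal.toZFSet_mem_toZFSet_iff]
    exact ZFSet.mem_vonNeumann.1 (h4 hx)
  · intro hx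
    obtain ⟨c, hc, rfl⟩ := Ordinal.mem_toZFSet_iff.1 hx
    exact (h3 _ (toZFSet_mem hc)).2 (ZFSet.isOrdinal_toZFSet c)

/-- An elementary embedding is the identity below its critical point. -/
theorem eq_self (E : Emb P l t f) (hl : IsSuccLimit l) {c : Ordinal.{u}} (hc : c ≤ l)
    (h : ∀ a < c, f a.toZFSet = a.toZFSet) : ∀ x ∈ vonNeumann c, f x = x := by
  intro x
  induction x using WellFounded.induction (InvImage.wf ZFSet.rank Ordinal.lt_wf) with
  | _ x ih =>
    intro hx
    have hxc := ZFSet.mem_vonNeumann.1 hx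
    have hxl : x ∈ vonNeumann l := ZFSet.vonNeumann_subset_of_le hc hx
    have hr : x.rank < l := hxc.trans_le hc
    obtain ⟨b, _, h1, h2⟩ := E.exists_level hl hr
    rw [h _ hxc] at h2
    obtain rfl := Ordinal.toZFSet_injective h2
    -- Since `V_{rank x}` is fixed, `f x` contains only sets of rank below `rank x`, which are fixed
    -- by induction; hence `f x` and `x` have the same elements.
    have h3 := (E.subset hxl (by simpa using hr)).1 (ZFSet.subset_vonNeumann_self x)
    rw [h1] at h3
    have key : ∀ y ∈ vonNeumann x.rank, f y = y ∧ y ∈ vonNeumann l := fun y hy => by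
      have hyx := ZFSet.mem_vonNeumann.1 hy
      exact ⟨ih y hyx (ZFSet.mem_vonNeumann.2 (hyx.trans hxc)),
        ZFSet.mem_vonNeumann.2 (hyx.trans hr)⟩
    ext y
    constructor
    · intro hy
      obtain ⟨h4, h5⟩ := key y (h3 hy)
      rw [E.mem_iff h5 hxl, h4]
      exact hy
    · intro hy
      obtain ⟨h4, h5⟩ := key y (ZFSet.subset_vonNeumann_self x hy)
      rw [E.mem_iff h5 hxl, h4] at hy
      exact hy

/-- The critical point of an elementary embedding is a limit ordinal above `ω`. -/
theorem crit_limit (E : Emb P l t f) (hl : IsSuccLimit l) {c : Ordinal.{u}} (hc : c < l)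
    (h : ∀ a < c, f a.toZFSet = a.toZFSet) (hne : f c.toZFSet ≠ c.toZFSet) :
    IsSuccLimit c ∧ Ordinal.omega0 < c := by
  have hlim : IsSuccLimit c := by
    rcases Ordinal.zero_or_succ_or_isSuccLimit c with rfl | ⟨a, rfl⟩ | h'
    · exfalso
      have h1 := (E.del (R := fun e => ¬ (e 0).Nonempty) (Del.nonempty 0).not
        (v := fun _ => ∅) (fun _ => by simpa using toZFSet_mem hc)).1 (by simp)
      simp only [ZFSet.nonempty_def, not_exists] at h1
      exact hne (by rw [Ordinal.toZFSet_zero]; exact (ZFSet.eq_empty _).2 h1)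
    · exfalso
      have ha : a < l := (lt_succ a).trans hc
      have h1 := (E.del (Del.insertSelf 0 1) (v := push (succ a).toZFSet fun _ => a.toZFSet)
        (push_mem (toZFSet_mem hc) fun _ => toZFSet_mem ha)).1 (toZFSet_succ_eq a)
      have h2 : f (succ a).toZFSet = insert (f a.toZFSet) (f a.toZFSet) := h1
      rw [h a (lt_succ a), ← toZFSet_succ_eq] at h2
      exact hne h2
    · exact h'
  refine ⟨hlim, lt_of_le_of_ne (Ordinal.omega0_le_of_isSuccLimit hlim) ?_⟩
  rintro rfl
  obtain ⟨b, _, _, hb⟩ := E.exists_level hl hc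
  have hωb : Ordinal.omega0 ≤ b := le_of_forall_lt fun a ha => by
    have := (E.mem_iff (toZFSet_mem (ha.trans hc)) (toZFSet_mem hc)).1
      (Ordinal.toZFSet_mem_toZFSet_iff.2 ha)
    rwa [h a ha, hb, Ordinal.toZFSet_mem_toZFSet_iff] at this
  have hne' : Ordinal.omega0 ≠ b := fun h' => hne (by rw [hb, ← h'])
  -- Every element of `ω` is zero or a successor, and this passes to the image `b`. But `b > ω`
  -- would have `ω` as an element.
  have hR : Del P (fun e => ∀ x ∈ e 0, ¬ x.Nonempty ∨ ∃ y ∈ x, x = insert y y) :=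
    .ball 0 ((Del.nonempty _).not.or (.bex _ (Del.insertSelf _ _)))
  have h1 := (E.del hR (v := fun _ => Ordinal.omega0.toZFSet) fun _ => toZFSet_mem hc).1 (by
    intro x hx
    obtain ⟨a, ha, rfl⟩ := Ordinal.mem_toZFSet_iff.1 hx
    obtain ⟨n, rfl⟩ := Ordinal.lt_omega0.1 ha
    cases n with
    | zero => left; simp
    | succ n =>
      right
      refine ⟨(n : Ordinal).toZFSet, ?_, ?_⟩
      · rw [Ordinal.toZFSet_mem_toZFSet_iff]; exact_mod_cast n.lt_succ_self
      · rw [Nat.cast_succ, Ordinal.toZFSet_add_one])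
  simp only [hb] at h1
  rcases h1 _ (Ordinal.toZFSet_mem_toZFSet_iff.2 (lt_of_le_of_ne hωb hne')) with h2 | ⟨y, hy, h2⟩
  · refine h2 ⟨(0 : Ordinal).toZFSet, ?_⟩
    rw [SetLike.mem_coe, Ordinal.toZFSet_mem_toZFSet_iff]
    exact Ordinal.omega0_pos
  · obtain ⟨a, ha, rfl⟩ := Ordinal.mem_toZFSet_iff.1 hy
    rw [← toZFSet_succ_eq] at h2
    exact absurd (Ordinal.toZFSet_injective h2) (hlim.succ_lt ha).ne'

end Emb

/-- The function on the universe given by an elementary embedding. -/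
noncomputable def embFun {P : Class.{u}} {l t : Ordinal.{u}} (j : Level P l ↪ₑ[Lang] Level P t)
    (x : ZFSet.{u}) : ZFSet.{u} :=
  open Classical in
  if h : x ∈ vonNeumann l then (j ⟨x, h⟩).toSet else ∅

section
variable {P : Class.{u}} {l t : Ordinal.{u}} (j : Level P l ↪ₑ[Lang] Level P t)

theorem embFun_toSet (x : Level P l) : embFun j x.toSet = (j x).toSet := by
  have : x.toSet ∈ vonNeumann l := x.2
  rw [embFun, dif_pos this]
  rfl

theorem emb_embFun : Emb P l t (embFun j) where
  maps x hx := by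
    obtain ⟨y, rfl⟩ : ∃ y : Level P l, y.toSet = x := ⟨⟨x, hx⟩, rfl⟩
    rw [embFun_toSet]
    exact (j y).2
  sat φ v hv := by
    obtain ⟨w, rfl⟩ : ∃ w : ℕ → Level P l, (fun i => (w i).toSet) = v :=
      ⟨fun i => ⟨v i, hv i⟩, rfl⟩
    simp only [embFun_toSet]
    exact elementary_sat_iff j φ w

theorem mapsOrd_iff {a b : Ordinal.{u}} (ha : a < l) :
    MapsOrd j a b ↔ embFun j a.toZFSet = b.toZFSet := by
  constructor
  · rintro ⟨x, h1, h2⟩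
    rw [← h1, embFun_toSet, h2]
  · intro h
    obtain ⟨x, hx⟩ : ∃ x : Level P l, x.toSet = a.toZFSet := ⟨⟨_, Emb.toZFSet_mem ha⟩, rfl⟩
    exact ⟨x, hx, by rw [← embFun_toSet, hx, h]⟩

end

/-- Construction of elementary embeddings with prescribed critical point. -/
theorem Emb.exists_embedding {P : Class.{u}} {l t : Ordinal.{u}} {f : ZFSet.{u} → ZFSet.{u}}
    (E : Emb P l t f) (hl : IsSuccLimit l) {c d : Ordinal.{u}} (hc : c < l)
    (h : ∀ x ∈ vonNeumann c, f x = x) (hd : f (vonNeumann c) = vonNeumann d) (hcd : c < d) :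
    ∃ j : Level P l ↪ₑ[Lang] Level P t, (∀ x, (j x).toSet = f x.toSet) ∧ IsCrit j c ∧
      MapsOrd j c d := by
  obtain ⟨j, hj⟩ := exists_elementary hl.bot_lt f E.maps E.sat
  have hjf : ∀ x ∈ vonNeumann l, embFun j x = f x := fun x hx =>
    (embFun_toSet j ⟨x, hx⟩).trans (hj _)
  have hcd' : f c.toZFSet = d.toZFSet := by
    obtain ⟨b, _, h1, h2⟩ := E.exists_level hl hc
    rw [hd, ZFSet.vonNeumann_inj] at h1
    rw [h1, h2]
  refine ⟨j, hj, ⟨hc, fun a ha => ?_, ?_⟩, ?_⟩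
  · rw [mapsOrd_iff j (ha.trans hc), hjf _ (toZFSet_mem (ha.trans hc)), h _ (toZFSet_mem ha)]
  · rw [mapsOrd_iff j hc, hjf _ (toZFSet_mem hc), hcd', Ordinal.toZFSet_injective.eq_iff]
    exact hcd.ne'
  · rw [mapsOrd_iff j hc, hjf _ (toZFSet_mem hc), hcd']

end PredSet

namespace PredSet

open ZFSet (vonNeumann pair)
open Order FirstOrder

/-! ### Extendibility implies supercompactness -/

/-- For a fixed formula all quantifiers over the set structure are bounded by that set. So
embeddings respect truth in members of their domain and restrict to smaller levels. -/
theorem Del.satIn {P : Class.{u}} (φ : Fm) : ∀ (m : ℕ) (p : ℕ → ℕ),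
    Del P (fun e => Sat P (e m : Set ZFSet.{u}) (fun i => e (p i)) φ) := by
  induction φ with
  | eq i j => exact fun m p => .eq _ _
  | mem i j => exact fun m p => .mem _ _
  | pred i => exact fun m p => .pred _
  | bot => exact fun m p => .false
  | imp φ ψ h1 h2 => exact fun m p => (h1 m p).imp (h2 m p)
  | all φ ih =>
    intro m p
    refine Del.ball (R := fun e x => Sat P (e m : Set ZFSet.{u}) (push x fun i => e (p i)) φ) m ?_
    refine (ih (m + 1) (fun i => Nat.casesOn i 0 fun i => p i + 1)).congr fun e => ?_
    have : (fun i => e (Nat.casesOn i 0 fun i => p i + 1 : ℕ)) =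
        push (e 0) fun i => e (p i + 1) := by
      funext i; cases i <;> rfl
    rw [this]

theorem Emb.sat_in {P : Class.{u}} {l t : Ordinal.{u}} {f : ZFSet.{u} → ZFSet.{u}}
    (E : Emb P l t f) {M : ZFSet.{u}} (hM : M ∈ vonNeumann l) (φ : Fm) {v : ℕ → ZFSet.{u}}
    (hv : ∀ i, v i ∈ M) : Sat P (M : Set ZFSet.{u}) v φ ↔
      Sat P (f M : Set ZFSet.{u}) (fun i => f (v i)) φ :=
  E.del (Del.satIn φ 0 (· + 1)) (v := push M v)
    (push_mem hM fun i => ZFSet.isTransitive_vonNeumann l _ hM (hv i))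

theorem Emb.restrict {P : Class.{u}} {l t a b : Ordinal.{u}} {f : ZFSet.{u} → ZFSet.{u}}
    (E : Emb P l t f) (ha : a < l) (h : f (vonNeumann a) = vonNeumann b) : Emb P a b f := by
  have hV : vonNeumann a ∈ vonNeumann l := by simpa using ha
  refine ⟨fun x hx => ?_, fun φ v hv => ?_⟩
  · rw [← h]
    exact (E.mem_iff (ZFSet.isTransitive_vonNeumann l _ hV hx) hV).1 hx
  · rw [← h]
    exact E.sat_in hV φ hv

theorem exists_of_mem_codes {c : ZFSet.{u}} (h : c ∈ stdK 9) : ∃ φ : Fm, num φ.code = c :=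
  ZFSet.mem_range.1 h

theorem Emb.elemT {P : Class.{u}} {l t : Ordinal.{u}} {f : ZFSet.{u} → ZFSet.{u}}
    (E : Emb P l t f) (hl : 0 < l) :
    ElemT P stdK (stdK 9) (vonNeumann l) (vonNeumann t) (graph f (vonNeumann l) (vonNeumann t))
      (fullF (vonNeumann l)) (fullT P (vonNeumann l)) (fullF (vonNeumann t))
      (fullT P (vonNeumann t)) := by
  refine elemT_full ⟨∅, ?_⟩ E.maps fun c hc => ?_
  · rw [SetLike.mem_coe, ZFSet.mem_vonNeumann, ZFSet.rank_empty]; exact hl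
  · obtain ⟨φ, rfl⟩ := exists_of_mem_codes hc
    exact ⟨φ, rfl, E.sat φ⟩

theorem ElemT.exists_emb {P : Class.{u}} {l t : Ordinal.{u}} {i F T F' T' : ZFSet.{u}}
    (h : ElemT P stdK (stdK 9) (vonNeumann l) (vonNeumann t) i F T F' T') :
    ∃ f, Emb P l t f ∧ ∀ a ∈ vonNeumann l, ∀ b ∈ vonNeumann t, pair a b ∈ i → f a = b := by
  obtain ⟨f, h1, h2, h3⟩ := h.sound
  exact ⟨f, ⟨h1, fun φ => h3 φ (ZFSet.mem_range.2 ⟨φ, rfl⟩)⟩, h2⟩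

/-- Inside `q` there is a level `t ∈ x` which is a `Σₙ₊₁`-elementary substructure of `x` and an
elementary embedding of `t` in `y` which sends its critical level to `x` and has `a` in its
range. -/
def LocalRefl (P : Class.{u}) (n : ℕ) (K : ℕ → ZFSet.{u}) (x y a q : ZFSet.{u}) : Prop :=
  ∃ t ∈ x, ∃ s ∈ t, ∃ a' ∈ t, (∃ h ∈ q, (∀ z ∈ q, HierAt h z) ∧ t ∈ h ∧ s ∈ h) ∧
    (∃ i ∈ q, ∃ F ∈ q, ∃ T ∈ q, ∃ F' ∈ q, ∃ T' ∈ q, ElemT P K (K 9) t y i F T F' T' ∧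
      (∀ z ∈ s, pair z z ∈ i) ∧ pair s x ∈ i ∧ pair a' a ∈ i) ∧
    ∃ i ∈ q, ∃ F ∈ q, ∃ T ∈ q, ∃ F' ∈ q, ∃ T' ∈ q, ElemT P K (K (n + 11)) t x i F T F' T' ∧
      ∀ z ∈ t, pair z z ∈ i

/-- The bound `q` on embeddings and satisfaction relations is what keeps the relation `Δ₀`; limit
levels far enough up serve as `q`. -/
theorem Del.localRefl (P : Class.{u}) (n : ℕ) (p : ℕ → ℕ) (x y a q : ℕ) :
    Del P (fun e => LocalRefl P n (fun i => e (p i)) (e x) (e y) (e a) (e q)) := by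
  unfold LocalRefl
  repeat' first
    | with_reducible exact Del.mem _ _ | with_reducible exact Del.pairMem _ _ _
    | with_reducible exact Del.hierAt _ _
    | with_reducible exact Del.elemT _ _ _ _ _ _ _ _ _
    | with_reducible apply Del.and | with_reducible apply Del.ball
    | with_reducible apply Del.bex

/-- Some elementary embedding of `y` in a `Σₙ`-correct level has critical level `s`, and sends it
to a `Σₙ`-correct level `u` which contains `y`. -/
def GlobalExt (P : Class.{u}) (n : ℕ) (K : ℕ → ZFSet.{u}) (s y : ZFSet.{u}) : Prop :=
  ∃ t u h i F T F' T', (IsHier h ∧ ITT P n K u ∧ ITT P n K t) ∧ t ∈ h ∧ u ∈ h ∧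
    ElemT P K (K 9) y t i F T F' T' ∧ (∀ z ∈ s, pair z z ∈ i) ∧ pair s u ∈ i ∧ y ∈ u ∧ u ∈ t

/-- Being a hierarchy is `Π₁`, absorbed into `Πₙ` because `n ≥ 1`; correctness is `Πₙ`, and the rest
is `Δ₀`. The existential quantifiers in front give `Σₙ₊₁`. -/
theorem sigD_globalExt (P : Class.{u}) {n : ℕ} (hn : 1 ≤ n) (p : ℕ → ℕ) (s y : ℕ) :
    SigD P (n + 1) (fun e => GlobalExt P n (fun i => e (p i)) (e s) (e y)) := by
  unfold GlobalExt
  refine SigD.exists (SigD.exists (SigD.exists (SigD.exists (SigD.exists (SigD.exists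
    (SigD.exists (SigD.exists (SigD.and (PiD.sigD ?_) (Del.sigD ?_)))))))))
  · refine PiD.and (PiD.mono hn ?_) (PiD.and (piD_itt P n _ _) (piD_itt P n _ _))
    exact PiD.forall (Del.hierAt _ _).piD
  · repeat' first
      | with_reducible exact Del.mem _ _ | with_reducible exact Del.pairMem _ _ _
      | with_reducible exact Del.elemT _ _ _ _ _ _ _ _ _
      | with_reducible apply Del.and | with_reducible apply Del.ball

theorem IsExtendible.isSigmaSupercompact {P : Class.{u}} {n : ℕ} (hn : 1 ≤ n) {κ : Cardinal.{u}}
    (H : IsExtendible P n κ) : IsSigmaSupercompact P (n + 1) κ := by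
  intro l hl hκl a
  have hll := Correct.isSuccLimit (by omega) hl
  -- `V_ν` will be the bound in `LocalRefl`, so it has to belong to the domain `V_μ` of the
  -- embedding.
  obtain ⟨ν, hlν, hν⟩ := exists_correct P l
  obtain ⟨μ, hνμ, hμ⟩ := exists_correct P ν.ord
  have hκμ : κ.ord < μ.ord := hκl.trans (hlν.trans hνμ)
  obtain ⟨t, j, ⟨-, hcrit, hmove⟩, b, hb, hμb, hmap⟩ := H μ (Cardinal.ord_lt_ord.1 hκμ) (hμ n)
  have E := emb_embFun j
  have hμl := Correct.isSuccLimit hn (hμ n)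
  generalize hf : embFun j = f at E
  have hcrit' : ∀ c < κ.ord, f c.toZFSet = c.toZFSet := fun c hc => by
    rw [← hf, ← mapsOrd_iff j (hc.trans hκμ)]
    exact hcrit c hc
  rw [mapsOrd_iff j hκμ, hf] at hmove hmap
  obtain ⟨hκlim, hκω⟩ := E.crit_limit hμl hκμ hcrit' hmove
  have hfix := E.eq_self hμl hκμ.le hcrit'
  have hκb : f (vonNeumann κ.ord) = vonNeumann b := by
    obtain ⟨b', _, h1, h2⟩ := E.exists_level hμl hκμ
    rw [hmap, Ordinal.toZFSet_injective.eq_iff] at h2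
    rw [h1, h2]
  obtain ⟨l', -, hl', -⟩ := E.exists_level hμl (hlν.trans hνμ)
  obtain ⟨ν', -, hν', -⟩ := E.exists_level hμl hνμ
  have hVκ : vonNeumann κ.ord ∈ vonNeumann μ.ord := by simpa using hκμ
  have hVl : vonNeumann l ∈ vonNeumann μ.ord := by simpa using hlν.trans hνμ
  have hVν : vonNeumann ν.ord ∈ vonNeumann μ.ord := by simpa using hνμ
  have hbl' : b < l' := by
    rw [← ZFSet.vonNeumann_mem_vonNeumann_iff, ← hκb, ← hl', ← E.mem_iff hVκ hVl]
    simpa using hκl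
  have hl'ν' : l' < ν' := by
    rw [← ZFSet.vonNeumann_mem_vonNeumann_iff, ← hl', ← hν', ← E.mem_iff hVl hVν]
    simpa using hlν
  have hνlim : IsSuccLimit ν' :=
    (E.restrict hνμ hν').isSuccLimit (Correct.isSuccLimit hn (hν n))
  have hlb : l < b := hlν.trans (hνμ.trans hμb)
  have hων' : Ordinal.omega0 < ν' := hκω.trans (hκl.trans (hlb.trans (hbl'.trans hl'ν')))
  -- Truth passes from `V_κ` to `V_b` along `f`, which fixes the parameters, then to `V_μ` by
  -- `TT.between`, and from there to the universe.
  have hTκ : TT P (n + 1) (vonNeumann κ.ord : Set ZFSet.{u}) := by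
    refine ⟨transClass_vonNeumann _, fun φ hφ v hv => ?_⟩
    have hvμ : ∀ i, v i ∈ vonNeumann μ.ord := fun i =>
      ZFSet.vonNeumann_subset_of_le hκμ.le (hv i)
    have h1 := E.sat_in hVκ φ hv
    rw [hκb, show (fun i => f (v i)) = v from funext fun i => hfix _ (hv i)] at h1
    rw [h1, ← (Correct.tt (hμ (n + 1))).between (Correct.tt hb)
      (ZFSet.vonNeumann_subset_of_le hμb.le) hφ hvμ]
    exact Correct.sat_iff (hμ (n + 1)) hφ hvμ
  have hK : ∀ i, stdK i ∈ vonNeumann κ.ord := stdK_mem hκω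
  have haμ : a.toSet ∈ vonNeumann μ.ord := ZFSet.isTransitive_vonNeumann _ _ hVl a.2
  have key := E.del (Del.localRefl P n (· + 4) 0 1 2 3)
    (v := push (vonNeumann κ.ord) (push (vonNeumann l) (push a.toSet (push (vonNeumann ν.ord)
      stdK)))) (push_mem hVκ (push_mem hVl (push_mem haμ (push_mem hVν fun i =>
        ZFSet.isTransitive_vonNeumann _ _ hVκ (hK i)))))
  change LocalRefl P n stdK (vonNeumann κ.ord) (vonNeumann l) a.toSet (vonNeumann ν.ord) ↔
    LocalRefl P n (fun i => f (stdK i)) (f (vonNeumann κ.ord)) (f (vonNeumann l)) (f a.toSet)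
      (f (vonNeumann ν.ord)) at key
  rw [show (fun i => f (stdK i)) = stdK from funext fun i => hfix _ (hK i), hκb, hl', hν'] at key
  have El := E.restrict (hlν.trans hνμ) hl'
  have hVlν' : vonNeumann l ∈ vonNeumann ν' := by simpa using hlb.trans (hbl'.trans hl'ν')
  have hVbν' : vonNeumann b ∈ vonNeumann ν' := by simpa using hbl'.trans hl'ν'
  have hVl'ν' : vonNeumann l' ∈ vonNeumann ν' := by simpa using hl'ν'
  have hκl' : vonNeumann κ.ord ∈ vonNeumann l := by simpa using hκl
  obtain ⟨t, ht, s, hs, a', ha', ⟨h, hh, hhier, hth, hsh⟩, ⟨i, -, F, -, T, -, F', -, T', -, hE,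
    hi, hsx, haa⟩, i2, -, F2, -, T2, -, F2', -, T2', -, hE2, hi2⟩ := key.2 (by
      -- The witnesses for the image statement are `V_l`, `V_κ` and `a` themselves, with the
      -- restriction of `f` to `V_l` and the inclusion of `V_l` in `V_b`.
      refine ⟨vonNeumann l, by simpa using hlb, vonNeumann κ.ord, hκl', a.toSet, a.2,
        ⟨hierSet l, hierSet_mem hνlim (hlb.trans (hbl'.trans hl'ν')),
          fun z _ => isHier_hierSet l z, mem_hierSet.2 ⟨l, le_rfl, rfl⟩,
          mem_hierSet.2 ⟨_, hκl.le, rfl⟩⟩,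
        ⟨_, graph_mem _ hνlim hVlν' hVl'ν', _, fullF_mem hνlim hων' hVlν', _,
          fullT_mem P hνlim hων' hVlν', _, fullF_mem hνlim hων' hVl'ν', _,
          fullT_mem P hνlim hων' hVl'ν', El.elemT hll.bot_lt, fun z hz => ?_, ?_, ?_⟩,
        ⟨_, graph_mem id hνlim hVlν' hVbν', _, fullF_mem hνlim hων' hVlν', _,
          fullT_mem P hνlim hων' hVlν', _, fullF_mem hνlim hων' hVbν', _,
          fullT_mem P hνlim hων' hVbν', elemT_full ⟨_, hκl'⟩
            (fun z hz => ZFSet.vonNeumann_subset_of_le hlb.le hz) fun c hc => ?_, fun z hz => ?_⟩⟩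
      · exact (pair_mem_graph (ZFSet.vonNeumann_subset_of_le hκl.le hz)
          (ZFSet.vonNeumann_subset_of_le (hκl.trans (hlb.trans hbl')).le hz)).2 (hfix z hz)
      · exact (pair_mem_graph hκl' (by simpa using hbl')).2 hκb
      · exact (pair_mem_graph a.2 (El.maps _ a.2)).2 rfl
      · obtain ⟨φ, hφ, rfl⟩ := exists_of_mem_stdK hc
        exact ⟨φ, rfl, fun v hv => (Correct.tt hl).between (Correct.tt hb)
          (ZFSet.vonNeumann_subset_of_le hlb.le) hφ hv⟩
      · exact (pair_mem_graph hz (ZFSet.vonNeumann_subset_of_le hlb.le hz)).2 rfl)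
  have hhier' : IsHier h := isHier_of_forall_mem hh hhier
  have htV := hhier'.eq_vonNeumann t hth
  have hsV := hhier'.eq_vonNeumann s hsh
  generalize t.rank = l'' at htV
  generalize s.rank = d at hsV
  subst htV hsV
  have hdl : d < l'' := by simpa using hs
  have hlκ : l'' < κ.ord := by simpa using ht
  have hlt : ∀ z ∈ vonNeumann l'', z ∈ vonNeumann l := fun z hz =>
    ZFSet.vonNeumann_subset_of_le (hlκ.trans hκl).le hz
  -- The second embedding is the identity, so the level is `Σₙ₊₁`-elementary in `V_κ`, which is
  -- itself `Σₙ₊₁`-correct.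
  have hlc : l'' ∈ Correct P (n + 1) := by
    refine TT.correct (bot_le.trans_lt hdl) ⟨transClass_vonNeumann _, fun φ hφ v hv => ?_⟩
    obtain ⟨g, h1, h2, h3⟩ := hE2.sound
    have hvκ : ∀ i, v i ∈ vonNeumann κ.ord := fun i =>
      ZFSet.vonNeumann_subset_of_le hlκ.le (hv i)
    rw [h3 φ (num_code_mem hφ) v hv, show (fun i => g (v i)) = v from funext fun i =>
      h2 _ (hv i) _ (hvκ i) (hi2 _ (hv i))]
    exact hTκ.2 φ hφ v hvκ
  obtain ⟨g, hg, hgi⟩ := hE.exists_emb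
  obtain ⟨j', h1, h2, h3⟩ := hg.exists_embedding (Correct.isSuccLimit (by omega) hlc) hdl
    (fun z hz => by
      have hz' := ZFSet.vonNeumann_subset_of_le hdl.le hz
      exact hgi _ hz' _ (hlt z hz') (hi z hz))
    (hgi _ hs _ hκl' hsx) (hdl.trans hlκ)
  refine ⟨d, l'', hdl, hlκ, hlc, ⟨a', ha'⟩, j', h2, h3, Subtype.ext ?_⟩
  exact (h1 _).trans (hgi _ ha' _ a.2 haa)

/-! ### Supercompactness implies the strong form of extendibility -/

theorem exists_bound {S : Set Ordinal.{u}} {b : Ordinal.{u}}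
    (h : ∀ a < b, ∃ c ∈ S, a < c ∧ c < b) {v : ℕ → ZFSet.{u}} (hv : ∀ i, v i ∈ vonNeumann b)
    (N : ℕ) : ∃ c ∈ S, c < b ∧ ∀ i ≤ N, v i ∈ vonNeumann c := by
  induction N with
  | zero =>
    obtain ⟨c, hc, h1, h2⟩ := h _ (ZFSet.mem_vonNeumann.1 (hv 0))
    exact ⟨c, hc, h2, fun i hi => by
      obtain rfl : i = 0 := by omega
      exact ZFSet.mem_vonNeumann.2 h1⟩
  | succ N ih =>
    obtain ⟨c, hc, hcb, ih⟩ := ih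
    obtain ⟨c', hc', h1, h2⟩ := h _ (max_lt hcb (ZFSet.mem_vonNeumann.1 (hv (N + 1))))
    refine ⟨c', hc', h2, fun i hi => ?_⟩
    rcases hi.lt_or_eq with hi | rfl
    · exact ZFSet.vonNeumann_subset_of_le ((le_max_left _ _).trans h1.le) (ih i (by omega))
    · exact ZFSet.mem_vonNeumann.2 ((le_max_right _ _).trans_lt h1)

/-- A limit of `Σₙ`-correct ordinals is `Σₙ`-correct. -/
theorem tt_of_limit {P : Class.{u}} {n : ℕ} {b : Ordinal.{u}}
    (h : ∀ a < b, ∃ c ∈ Correct P n, a < c ∧ c < b) : ∀ m ≤ n,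
      TT P m (vonNeumann b : Set ZFSet.{u}) := by
  intro m
  induction m with
  | zero => exact fun _ => TT.zero_iff.2 (transClass_vonNeumann b)
  | succ m ih =>
    intro hm
    have hb := ih (by omega)
    refine ⟨transClass_vonNeumann b, fun φ hφ v hv => ?_⟩
    obtain ⟨N, hN⟩ := exists_support.{u} φ
    obtain ⟨c, hc, hcb, hvc⟩ := exists_bound h hv N
    let w : ℕ → ZFSet.{u} := fun i => v (min i N)
    have hvw : ∀ i < N, v i = w i := fun i hi => by simp [w, min_eq_left hi.le]
    have hw : ∀ i, w i ∈ vonNeumann c := fun i => hvc _ (min_le_right _ _)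
    -- `V_c` is correct one level further than `V_b` is known to be, which is the situation of
    -- `TT.between`.
    have hc' : TT P (m + 1) (vonNeumann c : Set ZFSet.{u}) := (Correct.tt hc).mono hm
    rw [hN P _ v w hvw, hN P Set.univ v w hvw,
      ← hc'.between hb (ZFSet.vonNeumann_subset_of_le hcb.le) hφ hw]
    exact hc'.2 φ hφ w hw

/-- Put `a` in the range of an embedding sending its critical point `d` to `κ`. Its preimage is
below `d`, hence fixed, so `a < d < l < κ` with `l` correct. -/
theorem IsSigmaSupercompact.exists_correct_between {P : Class.{u}} {n : ℕ} {κ : Cardinal.{u}}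
    (H : IsSigmaSupercompact P n κ) : ∀ a < κ.ord, ∃ c ∈ Correct P n, a < c ∧ c < κ.ord := by
  intro a ha
  obtain ⟨L, hL, hLc⟩ := exists_correct P κ.ord
  obtain ⟨d, l, hdl, hlκ, hlc, a', j, ⟨-, hcrit, -⟩, hd, hja⟩ :=
    H L.ord (hLc n) hL ⟨a.toZFSet, Emb.toZFSet_mem (ha.trans hL)⟩
  refine ⟨l, hlc, ?_, hlκ⟩
  have E := emb_embFun j
  have h1 : embFun j a'.toSet = a.toZFSet := by
    rw [embFun_toSet, hja]
    rfl
  rw [mapsOrd_iff j hdl] at hd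
  have h2 : a'.toSet ∈ d.toZFSet := by
    rw [E.mem_iff (x := a'.toSet) a'.2 (Emb.toZFSet_mem hdl), h1, hd, Ordinal.toZFSet_mem_toZFSet_iff]
    exact ha
  obtain ⟨c, hc, hca⟩ := Ordinal.mem_toZFSet_iff.1 h2
  have h3 := (mapsOrd_iff j (hc.trans hdl)).1 (hcrit c hc)
  rw [hca, h1, ← hca, Ordinal.toZFSet_injective.eq_iff] at h3
  rw [h3]
  exact hc.trans hdl

theorem IsSigmaSupercompact.isExtendiblePlus {P : Class.{u}} {n : ℕ} (hn : 1 ≤ n)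
    {κ : Cardinal.{u}} (H : IsSigmaSupercompact P (n + 1) κ) : IsExtendiblePlus P n κ := by
  intro l hκl hl
  replace hκl : κ.ord < l.ord := Cardinal.ord_lt_ord.2 hκl
  have hTκ := tt_of_limit H.exists_correct_between n n.le_succ
  obtain ⟨L, hlL, hL⟩ := exists_correct P l.ord
  -- The parameter is the ordinal `l` itself, so that its preimage `m` gives a level `V_m` sent to
  -- `V_l`.
  obtain ⟨d, l', hdl, hlκ, hlc, y, j, ⟨-, hcrit, hmove⟩, hd, hjy⟩ :=
    H L.ord (hL _) (hκl.trans hlL) ⟨l.ord.toZFSet, Emb.toZFSet_mem hlL⟩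
  have E := emb_embFun j
  have hl'l := Correct.isSuccLimit (by omega) hlc
  have hfy : embFun j y.toSet = l.ord.toZFSet := by
    rw [embFun_toSet, hjy]
    rfl
  generalize hf : embFun j = f at E hfy
  have hcrit' : ∀ c < d, f c.toZFSet = c.toZFSet := fun c hc => by
    rw [← hf, ← mapsOrd_iff j (hc.trans hdl)]
    exact hcrit c hc
  rw [mapsOrd_iff j hdl, hf] at hmove hd
  obtain ⟨-, hdω⟩ := E.crit_limit hl'l hdl hcrit' hmove
  have hfix := E.eq_self hl'l hdl.le hcrit'
  have hdκ : f (vonNeumann d) = vonNeumann κ.ord := by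
    obtain ⟨b, _, h1, h2⟩ := E.exists_level hl'l hdl
    rw [hd, Ordinal.toZFSet_injective.eq_iff] at h2
    rw [h1, h2]
  have hyo : y.toSet.IsOrdinal := by
    refine (E.del (Del.isOrdinal 0) (v := fun _ => y.toSet) fun _ => y.2).2 ?_
    change (f y.toSet).IsOrdinal
    rw [hfy]
    exact ZFSet.isOrdinal_toZFSet _
  obtain ⟨m, hm⟩ : ∃ m : Ordinal.{u}, m.toZFSet = y.toSet := ⟨_, hyo.toZFSet_rank_eq⟩
  have hml : m < l' := by
    have := ZFSet.mem_vonNeumann.1 y.2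
    change y.toSet.rank < l' at this
    rwa [← hm, Ordinal.rank_toZFSet] at this
  rw [← hm] at hfy
  have hfm : f (vonNeumann m) = vonNeumann l.ord := by
    obtain ⟨b, _, h1, h2⟩ := E.exists_level hl'l hml
    rw [hfy, Ordinal.toZFSet_injective.eq_iff] at h2
    rw [h1, h2]
  have hVd : vonNeumann d ∈ vonNeumann l' := by simpa using hdl
  have hVm : vonNeumann m ∈ vonNeumann l' := by simpa using hml
  have hdm : d < m := by
    rw [← ZFSet.vonNeumann_mem_vonNeumann_iff, E.mem_iff hVd hVm, hdκ, hfm]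
    simpa using hκl
  have Em := E.restrict hml hfm
  have hVdm : vonNeumann d ∈ vonNeumann m := by simpa using hdm
  have hVκl : vonNeumann κ.ord ∈ vonNeumann l.ord := by simpa using hκl
  -- The embedding itself is the witness: it sends `V_m` to `V_l` and `V_d` to `V_κ`, both
  -- `Σₙ`-correct, and `m < l' < κ`.
  have hG : GlobalExt P n stdK (vonNeumann d) (vonNeumann m) := by
    refine ⟨vonNeumann l.ord, vonNeumann κ.ord, hierSet l.ord, _, _, _, _, _,
      ⟨isHier_hierSet _, (itt_iff P n _).2 hTκ, (itt_iff P n _).2 (Correct.tt hl)⟩,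
      mem_hierSet.2 ⟨_, le_rfl, rfl⟩, mem_hierSet.2 ⟨_, hκl.le, rfl⟩,
      Em.elemT (bot_le.trans_lt hdm), fun z hz => ?_, ?_, ?_, hVκl⟩
    · exact (pair_mem_graph (ZFSet.vonNeumann_subset_of_le hdm.le hz)
        (ZFSet.vonNeumann_subset_of_le ((hdl.trans hlκ).trans hκl).le hz)).2 (hfix z hz)
    · exact (pair_mem_graph hVdm hVκl).2 hdκ
    · simpa using hml.trans hlκ
  have hK : ∀ i, stdK i ∈ vonNeumann d := stdK_mem hdω
  obtain ⟨φ, hφ, hφG⟩ := sigD_globalExt P hn (· + 2) 0 1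
  let v : ℕ → ZFSet.{u} := push (vonNeumann d) (push (vonNeumann m) stdK)
  have hv : ∀ i, v i ∈ vonNeumann l' := push_mem hVd (push_mem hVm fun i =>
    ZFSet.isTransitive_vonNeumann _ _ hVd (hK i))
  have hfv : (fun i => f (v i)) = push (vonNeumann κ.ord) (push (vonNeumann l.ord) stdK) := by
    simp only [v, comp_push, hdκ, hfm]
    congr 2
    exact funext fun i => hfix _ (hK i)
  -- The `Σₙ₊₁` statement descends to `V_{l'}` and moves along `f` to `V_L`; the next step lifts it
  -- to the universe.
  have h1 := (E.sat φ v hv).1 ((Correct.sat_iff hlc hφ hv).2 ((hφG v).2 hG))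
  have h2 := (hφG _).1 ((Correct.sat_iff (hL (n + 1)) hφ fun i => E.maps _ (hv i)).1 h1)
  rw [hfv] at h2
  change GlobalExt P n stdK (vonNeumann κ.ord) (vonNeumann l.ord) at h2
  obtain ⟨t, u, h, i, F, T, F', T', ⟨hh, hu, ht⟩, hth, huh, hE, hi, hsu, hlu, hut⟩ := h2
  have htV := hh.eq_vonNeumann t hth
  have huV := hh.eq_vonNeumann u huh
  generalize t.rank = θ at htV
  generalize u.rank = b at huV
  subst htV huV
  have hlb : l.ord < b := by simpa using hlu
  have hbθ : b < θ := by simpa using hut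
  have hθc : θ ∈ Correct P n := TT.correct (bot_le.trans_lt hbθ) ((itt_iff P n _).1 ht)
  have hbc : b ∈ Correct P n := TT.correct (bot_le.trans_lt hlb) ((itt_iff P n _).1 hu)
  obtain ⟨g, hg, hgi⟩ := hE.exists_emb
  obtain ⟨j', -, h2, h3⟩ := hg.exists_embedding (Correct.isSuccLimit hn hl) hκl
    (fun z hz => hgi _ (ZFSet.vonNeumann_subset_of_le hκl.le hz) _
      (ZFSet.vonNeumann_subset_of_le (hκl.trans (hlb.trans hbθ)).le hz) (hi z hz))
    (hgi _ hVκl _ hut hsu) (hκl.trans hlb)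
  exact ⟨θ, hθc, j', h2, b, hbc, hlb, h3⟩

theorem IsExtendiblePlus.isExtendible {P : Class.{u}} {n : ℕ} {κ : Cardinal.{u}}
    (H : IsExtendiblePlus P n κ) : IsExtendible P n κ := fun l h1 h2 =>
  let ⟨t, _, h⟩ := H l h1 h2
  ⟨t, h⟩

end PredSet

theorem theorem11p3 (n : ℕ) (hn : 1 ≤ n) (P : Class.{u}) (κ : Cardinal.{u}) :
    [PredSet.IsExtendible P n κ,
      PredSet.IsSigmaSupercompact P (n + 1) κ,
      PredSet.IsExtendiblePlus P n κ].TFAE := by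
  tfae_have 1 → 2 := fun h => h.isSigmaSupercompact hn
  tfae_have 2 → 3 := fun h => h.isExtendiblePlus hn
  tfae_have 3 → 1 := fun h => h.isExtendible
  tfae_finish
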